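/- Let $\mathbb{T}^2=\mathbb{R}^2/\mathbb{Z}^2$. Let $Z=\mathbb{T}^2\times\mathbb{R}$ with the Riemannian metric $dt^2+e^{2t}(dx^2+dy^2)$, and let $Z'=\mathbb{T}^2\times\mathbb{R}$ with the Riemannian metric $dt^2+(e^{t\alpha})^*(dx^2+dy^2)$, $\alpha=\begin{pmatrix}1&1\\0&1\end{pmatrix}$, that is, $dt^2+e^{2t}\big(dx^2+2t\,dx\,dy+(t^2+1)\,dy^2\big)$. Give both spaces the Riemannian distance and the base point $O=(0,0,0)$, resp. $O'=(0,0,0)$. The ideal boundary $\partial X$ of a space $X$ is the set of asymptoty classes of its geodesic rays (with the topology induced by uniform convergence of rays on compact sets), and the visual distance seen from $o\in X$ is $d_{o}(\xi,\eta)=e^{-(\xi|\eta)_o}$, where $(\xi|\eta)_o$ is the Gromov product. Then: 1. $Z$ and $Z'$ are not quasi-isometric. 2. There is a homeomorphism $\theta:\partial Z\to\partial Z'$ which is the identity on $\mathbb{T}^2$, in the sense that for every $P\in\mathbb{T}^2$ it sends the endpoint of the geodesic ray $t\mapsto(P,t)$, $t\ge 0$, of $Z$ to the endpoint of the geodesic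 ray $t\mapsto(P,t)$, $t\ge0$, of $Z'$, and whose distortion function $$K(R)=\sup\left\{\left|\log\frac{d_{O'}(\theta(\xi_1),\theta(\xi_2))}{d_{O}(\xi_1,\xi_2)}\right| \;:\; d_{O}(\xi_1,\xi_2)\ge e^{-R}\ \text{ or }\ d_{O'}(\theta(\xi_1),\theta(\xi_2))\ge e^{-R}\right\}$$ satisfies $K(R)\le C\log R$ for all $R\ge 2$, with a constant $C$. 3. The quasi-isometric distortion growth between $Z$ and $Z'$ is at most logarithmic. Let $D_G(X,x_0,Y,y_0)(R)$ be the infimum of $\lambda+c$ over all $\lambda>0$, $c\ge 0$ for which there is a map $f:B_X(x_0,R)\to Y$ with $f(x_0)=y_0$ and $\frac1\lambda(|p-q|-c)\le|f(p)-f(q)|\le\lambda|p-q|+c$ for all $p,q$. Then there is a constant $C$ such that for all $R\ge2$ $$D_G(Z,O,Z',O')(R)\le C\log R\quad\text{and}\quad D_G(Z',O',Z,O)(R)\le C\log R .$$ Moreover there is a constant $C$ such that for all $R\ge 2$ there are $\lambda>0$, $c\ge0$ with $\lambda+c\le C\log R$ and maps $f:B_Z(O,R)\to B_{Z'}(O',R)$,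 $g:B_{Z'}(O',R)\to B_Z(O,R)$ between the closed balls, both satisfying $|h(p)-h(q)|\le\lambda|p-q|+c$ for $h=f,g$, with $|g(f(p))-p|\le c$ and $|f(g(p'))-p'|\le c$ for all $p,p'$. -/

import Mathlib

open Manifold Bundle MeasureTheory Set Filter
open scoped ContDiff ENNReal NNReal Topology

noncomputable section

/-! ## Coarse geometry of (pseudo-)metric spaces -/

section CoarseGeometry

variable {X Y : Type*} [PseudoMetricSpace X] [PseudoMetricSpace Y]

/-- `f : X → Y` and `g : Y → X` are coarsely `(lam, c)`-Lipschitz and inverse to each other up to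
distance `c`. -/
structure IsQuasiIsometryPair (lam c : ℝ) (f : X → Y) (g : Y → X) : Prop where
  lam_pos : 0 < lam
  c_nonneg : 0 ≤ c
  dist_map_le : ∀ x y, dist (f x) (f y) ≤ lam * dist x y + c
  dist_inv_le : ∀ x y, dist (g x) (g y) ≤ lam * dist x y + c
  dist_left_inv : ∀ x, dist (g (f x)) x ≤ c
  dist_right_inv : ∀ y, dist (f (g y)) y ≤ c

variable (X Y) in
/-- `X` and `Y` are (roughly) quasi-isometric. -/
def QuasiIsometric : Prop :=
  ∃ (lam c : ℝ) (f : X → Y) (g : Y → X), IsQuasiIsometryPair lam c f g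

/-- `f` is a `(lam, c)`-quasi-isometric embedding. -/
structure IsQuasiIsometricEmbedding (lam c : ℝ) (f : X → Y) : Prop where
  lam_pos : 0 < lam
  c_nonneg : 0 ≤ c
  le_dist : ∀ x y, 1 / lam * (dist x y - c) ≤ dist (f x) (f y)
  dist_le : ∀ x y, dist (f x) (f y) ≤ lam * dist x y + c

/-- The quasi-isometric distortion growth: the infimum of `lam + c` over all base-point preserving
`(lam, c)`-quasi-isometric embeddings of the ball `B(x₀, R)` of `X` into `Y`. -/
def distortionGrowth (x₀ : X) (y₀ : Y) (R : ℝ) : ℝ≥0∞ :=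
  ⨅ (lam : ℝ) (c : ℝ) (f : Metric.closedBall x₀ R → Y)
    (_ : IsQuasiIsometricEmbedding lam c f)
    (_ : ∀ p : Metric.closedBall x₀ R, (p : X) = x₀ → f p = y₀), ENNReal.ofReal (lam + c)

variable (X) in
/-- Geodesic rays of `X`. As a subtype of the space of all maps, this space carries the topology of
pointwise convergence, which for isometric embeddings is that of uniform convergence on compact
sets. -/
abbrev GeodesicRay : Type _ := {γ : ℝ≥0 → X // Isometry γ}

variable (X) in
/-- Two geodesic rays are asymptotic if they stay at bounded distance from each other. -/
def asymptoticSetoid : Setoid (GeodesicRay X) where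
  r γ η := ∃ C : ℝ, ∀ r, dist (γ.1 r) (η.1 r) ≤ C
  iseqv :=
    { refl := fun γ ↦ ⟨0, fun r ↦ by simp⟩
      symm := fun ⟨C, h⟩ ↦ ⟨C, fun r ↦ by rw [dist_comm]; exact h r⟩
      trans := fun ⟨C, h⟩ ⟨C', h'⟩ ↦
        ⟨C + C', fun r ↦ (dist_triangle _ _ _).trans (add_le_add (h r) (h' r))⟩ }

variable (X) in
/-- The ideal boundary: asymptoty classes of geodesic rays, with the quotient topology. -/
def IdealBoundary : Type _ := Quotient (asymptoticSetoid X)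

instance : TopologicalSpace (IdealBoundary X) :=
  inferInstanceAs (TopologicalSpace (Quotient (asymptoticSetoid X)))

/-- The endpoint at infinity of a geodesic ray. -/
def GeodesicRay.endpoint (γ : GeodesicRay X) : IdealBoundary X :=
  Quotient.mk (asymptoticSetoid X) γ

/-- The Gromov product `(x|y)` based at `o`. -/
def gromovProduct (o x y : X) : ℝ := (dist x o + dist y o - dist x y) / 2

/-- The Gromov product of two points of the ideal boundary (with value `⊤` allowed). -/
def boundaryGromovProduct (o : X) (ξ η : IdealBoundary X) : EReal :=
  ⨆ (γ : GeodesicRay X) (γ' : GeodesicRay X) (_ : γ.endpoint = ξ) (_ : γ'.endpoint = η),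
    liminf (fun p : ℝ≥0 × ℝ≥0 ↦ (gromovProduct o (γ.1 p.1) (γ'.1 p.2) : EReal)) atTop

/-- The visual distance `exp (-(ξ|η))` seen from `o`. -/
def visualDist (o : X) (ξ η : IdealBoundary X) : ℝ≥0∞ :=
  EReal.exp (-boundaryGromovProduct o ξ η)

/-- The function `K(R)` of a map `θ` between ideal boundaries: the supremum of
`|log (d(θ ξ₁, θ ξ₂) / d(ξ₁, ξ₂))|` over all `ξ₁, ξ₂` for which at least one of the two visual
distances is at least `exp (-R)`. -/
def boundaryDistortion (x₀ : X) (y₀ : Y) (θ : IdealBoundary X → IdealBoundary Y) (R : ℝ) : ℝ≥0∞ :=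
  ⨆ (ξ₁ : IdealBoundary X) (ξ₂ : IdealBoundary X)
    (_ : ENNReal.ofReal (Real.exp (-R)) ≤ visualDist x₀ ξ₁ ξ₂ ∨
      ENNReal.ofReal (Real.exp (-R)) ≤ visualDist y₀ (θ ξ₁) (θ ξ₂)),
    (ENNReal.log (visualDist y₀ (θ ξ₁) (θ ξ₂) / visualDist x₀ ξ₁ ξ₂)).abs

end CoarseGeometry

/-! ## The Riemannian metrics on `ℝ² × ℝ` -/

/-- The manifold `ℝ² × ℝ`, with coordinates `(x, y, t)`, which is going to carry the Riemannian
metric `dt² + (e^{tα})^* (dx² + dy²)`, where `α` is the matrix with rows `(1, s)` and `(0, 1)`.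
Since `e^{tα}` has rows `(e^t, s t e^t)` and `(0, e^t)`, this is the metric
`dt² + e^{2t} ((dx + s t dy)² + dy²)`. -/
def TwistedCover (_s : ℝ) : Type := ℝ × ℝ × ℝ

namespace TwistedCover

variable {s : ℝ}

instance : TopologicalSpace (TwistedCover s) := inferInstanceAs (TopologicalSpace (ℝ × ℝ × ℝ))

instance : ChartedSpace (ℝ × ℝ × ℝ) (TwistedCover s) :=
  inferInstanceAs (ChartedSpace (ℝ × ℝ × ℝ) (ℝ × ℝ × ℝ))

instance : IsManifold 𝓘(ℝ, ℝ × ℝ × ℝ) ∞ (TwistedCover s) :=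
  inferInstanceAs (IsManifold 𝓘(ℝ, ℝ × ℝ × ℝ) ∞ (ℝ × ℝ × ℝ))

/-- The `1`-form `e^t dx + s t e^t dy`. -/
def coframe₁ (s : ℝ) (p : ℝ × ℝ × ℝ) : ℝ × ℝ × ℝ →L[ℝ] ℝ :=
  Real.exp p.2.2 • (ContinuousLinearMap.fst ℝ ℝ (ℝ × ℝ) +
    (s * p.2.2) • (ContinuousLinearMap.fst ℝ ℝ ℝ ∘L ContinuousLinearMap.snd ℝ ℝ (ℝ × ℝ)))

/-- The `1`-form `e^t dy`. -/
def coframe₂ (p : ℝ × ℝ × ℝ) : ℝ × ℝ × ℝ →L[ℝ] ℝ :=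
  Real.exp p.2.2 • (ContinuousLinearMap.fst ℝ ℝ ℝ ∘L ContinuousLinearMap.snd ℝ ℝ (ℝ × ℝ))

/-- The `1`-form `dt`. -/
def coframe₃ : ℝ × ℝ × ℝ →L[ℝ] ℝ :=
  ContinuousLinearMap.snd ℝ ℝ ℝ ∘L ContinuousLinearMap.snd ℝ ℝ (ℝ × ℝ)

/-- The metric tensor, as the sum of the squares of the three `1`-forms. -/
def form (s : ℝ) (p : ℝ × ℝ × ℝ) : ℝ × ℝ × ℝ →L[ℝ] ℝ × ℝ × ℝ →L[ℝ] ℝ :=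
  (coframe₁ s p).smulRight (coframe₁ s p) + (coframe₂ p).smulRight (coframe₂ p) +
    coframe₃.smulRight coframe₃

theorem form_apply (s : ℝ) (p v w : ℝ × ℝ × ℝ) : form s p v w =
    v.2.2 * w.2.2 + Real.exp p.2.2 ^ 2 *
      ((v.1 + s * p.2.2 * v.2.1) * (w.1 + s * p.2.2 * w.2.1) + v.2.1 * w.2.1) := by
  simp [form, coframe₁, coframe₂, coframe₃]
  ring

theorem form_pos (s : ℝ) (p v : ℝ × ℝ × ℝ) (hv : v ≠ 0) : 0 < form s p v v := by
  rw [form_apply]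
  have he : 0 < Real.exp p.2.2 ^ 2 := by positivity
  have k1 := mul_self_nonneg v.2.2
  have k2 := mul_self_nonneg (v.1 + s * p.2.2 * v.2.1)
  have k3 := mul_self_nonneg v.2.1
  have k4 := mul_nonneg he.le (add_nonneg k2 k3)
  refine lt_of_le_of_ne (add_nonneg k1 k4) fun h ↦ hv ?_
  have h1 : v.2.2 = 0 := mul_self_eq_zero.1 (by linarith)
  have h0 : Real.exp p.2.2 ^ 2 * ((v.1 + s * p.2.2 * v.2.1) * (v.1 + s * p.2.2 * v.2.1) +
      v.2.1 * v.2.1) = 0 := by linarith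
  have h2 := (mul_eq_zero.1 h0).resolve_left he.ne'
  have h3 : v.2.1 = 0 := mul_self_eq_zero.1 (by linarith)
  have h4 : v.1 = 0 := by
    rw [h3] at h2
    simpa using h2
  exact Prod.ext h4 (Prod.ext h3 h1)

theorem form_isVonNBounded (s : ℝ) (p : ℝ × ℝ × ℝ) :
    Bornology.IsVonNBounded ℝ {v : ℝ × ℝ × ℝ | form s p v v < 1} := by
  rw [NormedSpace.isVonNBounded_iff, isBounded_iff_forall_norm_le]
  have he : 0 < Real.exp p.2.2 := by positivity
  refine ⟨1 + (1 + |s * p.2.2|) / Real.exp p.2.2, fun v hv ↦ ?_⟩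
  have hv' : form s p v v < 1 := hv
  rw [form_apply] at hv'
  have hc : 0 ≤ |s * p.2.2| := abs_nonneg _
  have e2 : 0 ≤ (Real.exp p.2.2 * v.2.1) ^ 2 := sq_nonneg _
  have e1 : 0 ≤ (Real.exp p.2.2 * (v.1 + s * p.2.2 * v.2.1)) ^ 2 := sq_nonneg _
  have e3 : 0 ≤ v.2.2 ^ 2 := sq_nonneg _
  have k3 : |v.2.2| ≤ 1 := (sq_le_one_iff_abs_le_one _).1 (by nlinarith)
  have k2 : |Real.exp p.2.2 * v.2.1| ≤ 1 := (sq_le_one_iff_abs_le_one _).1 (by nlinarith)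
  have k1 : |Real.exp p.2.2 * (v.1 + s * p.2.2 * v.2.1)| ≤ 1 :=
    (sq_le_one_iff_abs_le_one _).1 (by nlinarith)
  rw [abs_mul, abs_of_pos he, ← le_div_iff₀' he] at k1 k2
  have k4 : |v.1| ≤ (1 + |s * p.2.2|) / Real.exp p.2.2 := by
    calc |v.1| = |(v.1 + s * p.2.2 * v.2.1) - s * p.2.2 * v.2.1| := by ring_nf
      _ ≤ |v.1 + s * p.2.2 * v.2.1| + |s * p.2.2 * v.2.1| := abs_sub _ _
      _ ≤ 1 / Real.exp p.2.2 + |s * p.2.2| * (1 / Real.exp p.2.2) := by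
        rw [abs_mul (s * p.2.2)]
        gcongr
      _ = _ := by ring
  have k5 : 1 / Real.exp p.2.2 ≤ (1 + |s * p.2.2|) / Real.exp p.2.2 := by
    gcongr
    linarith
  have k6 : 0 ≤ 1 / Real.exp p.2.2 := by positivity
  simp only [Prod.norm_def, Real.norm_eq_abs]
  refine max_le (by linarith) (max_le (by linarith) (by linarith))

/-- The Riemannian metric. -/
def metric (s : ℝ) : RiemannianMetric
    (fun p : TwistedCover s ↦ TangentSpace 𝓘(ℝ, ℝ × ℝ × ℝ) p) where
  inner p := form s p
  symm p v w := by
    erw [form_apply, form_apply]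
    ring
  pos p v hv := form_pos s p v hv
  continuousAt p := by
    have h : Continuous fun v : ℝ × ℝ × ℝ ↦ form s p v v := by fun_prop
    exact h.continuousAt
  isVonNBounded p := form_isVonNBounded s p

instance : RiemannianBundle (fun p : TwistedCover s ↦ TangentSpace 𝓘(ℝ, ℝ × ℝ × ℝ) p) :=
  ⟨metric s⟩

theorem norm_tangent (p : TwistedCover s) (v : TangentSpace 𝓘(ℝ, ℝ × ℝ × ℝ) p) :
    ‖v‖ = √(form s p v v) := by
  rw [norm_eq_sqrt_real_inner]
  rfl

end TwistedCover

namespace TwistedCover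

variable {s : ℝ}

theorem enorm_tangent (p : TwistedCover s) (v : TangentSpace 𝓘(ℝ, ℝ × ℝ × ℝ) p) :
    ‖v‖ₑ = ENNReal.ofReal √(form s p v v) := by
  rw [← ofReal_norm, norm_tangent]

/-- The length of a curve, in coordinates. -/
theorem pathELength_eq (γ : ℝ → ℝ × ℝ × ℝ) (a b : ℝ) :
    pathELength (M := TwistedCover s) 𝓘(ℝ, ℝ × ℝ × ℝ) γ a b =
      ∫⁻ r in Icc a b, ENNReal.ofReal √(form s (γ r) (deriv γ r) (deriv γ r)) := by
  refine (pathELength_eq_lintegral_mfderiv_Icc (M := TwistedCover s)).trans ?_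
  refine lintegral_congr fun r ↦ ?_
  refine (enorm_tangent (s := s) (γ r) _).trans ?_
  have : mfderiv 𝓘(ℝ, ℝ) 𝓘(ℝ, ℝ × ℝ × ℝ) (M' := ℝ × ℝ × ℝ) γ r = fderiv ℝ γ r := mfderiv_eq_fderiv
  have h2 : mfderiv 𝓘(ℝ, ℝ) 𝓘(ℝ, ℝ × ℝ × ℝ) (M' := ℝ × ℝ × ℝ) γ r (1 : ℝ) = deriv γ r := by
    rw [this]
    rfl
  exact congrArg (fun w : ℝ × ℝ × ℝ ↦ ENNReal.ofReal √(form s (γ r) w w)) h2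

/-- The Riemannian distance of `ℝ² × ℝ`. -/
def rdist (p q : TwistedCover s) : ℝ≥0∞ := riemannianEDist 𝓘(ℝ, ℝ × ℝ × ℝ) p q

theorem rdist_self (p : TwistedCover s) : rdist p p = 0 := riemannianEDist_self

theorem rdist_comm (p q : TwistedCover s) : rdist p q = rdist q p := riemannianEDist_comm

theorem rdist_triangle (p q r : TwistedCover s) : rdist p r ≤ rdist p q + rdist q r :=
  riemannianEDist_triangle

theorem rdist_le {γ : ℝ → ℝ × ℝ × ℝ} (hγ : ContDiffOn ℝ 1 γ (Icc 0 1)) :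
    rdist (s := s) (γ 0) (γ 1) ≤
      ∫⁻ r in Icc 0 1, ENNReal.ofReal √(form s (γ r) (deriv γ r) (deriv γ r)) := by
  rw [← pathELength_eq]
  exact riemannianEDist_le_pathELength (M := TwistedCover s) (contMDiffOn_iff_contDiffOn.2 hγ)
    rfl rfl zero_le_one

theorem exists_of_rdist_lt {p q : TwistedCover s} {L : ℝ≥0∞} (h : rdist p q < L) :
    ∃ γ : ℝ → ℝ × ℝ × ℝ, γ 0 = p ∧ γ 1 = q ∧ ContDiffOn ℝ 1 γ (Icc 0 1) ∧
      ∫⁻ r in Icc 0 1, ENNReal.ofReal √(form s (γ r) (deriv γ r) (deriv γ r)) < L := by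
  obtain ⟨γ, h0, h1, hγ, hL⟩ := exists_lt_of_riemannianEDist_lt h
  exact ⟨γ, h0, h1, contMDiffOn_iff_contDiffOn.1 hγ, (pathELength_eq γ 0 1).symm.trans_lt hL⟩

theorem rdist_ne_top (p q : TwistedCover s) : rdist p q ≠ ⊤ := by
  let γ : ℝ → ℝ × ℝ × ℝ := fun r ↦
    (p.1 + r * (q.1 - p.1), p.2.1 + r * (q.2.1 - p.2.1), p.2.2 + r * (q.2.2 - p.2.2))
  have hγ : ContDiff ℝ 1 γ := by fun_prop
  have h0 : γ 0 = p := by simp [γ]; rfl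
  have h1 : γ 1 = q := by simp [γ]; rfl
  have hd : Continuous (deriv γ) := hγ.continuous_deriv le_rfl
  have hc : Continuous fun r ↦ √(form s (γ r) (deriv γ r) (deriv γ r)) := by
    have := hγ.continuous
    simp only [form_apply]
    fun_prop
  have h := rdist_le (s := s) hγ.contDiffOn
  rw [h0, h1] at h
  exact (h.trans_lt (hc.integrableOn_Icc (a := 0) (b := 1)).setLIntegral_lt_top).ne

/-- The translation by `(a, b, 0)`. -/
def translate (a b : ℝ) (p : TwistedCover s) : TwistedCover s := (p.1 + a, p.2.1 + b, p.2.2)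

theorem rdist_translate_le (a b : ℝ) (p q : TwistedCover s) :
    rdist (translate a b p) (translate a b q) ≤ rdist p q := by
  refine le_of_forall_gt fun L hL ↦ ?_
  obtain ⟨γ, h0, h1, hγ, hlt⟩ := exists_of_rdist_lt hL
  have hη : ContDiffOn ℝ 1 (fun r ↦ γ r + ((a, b, 0) : ℝ × ℝ × ℝ)) (Icc 0 1) :=
    hγ.add contDiffOn_const
  have e (p : ℝ × ℝ × ℝ) : p + ((a, b, 0) : ℝ × ℝ × ℝ) = translate (s := s) a b p := by
    exact Prod.ext rfl (Prod.ext rfl (add_zero p.2.2))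
  have h := rdist_le (s := s) hη
  simp only [h0, h1] at h
  refine ((e p ▸ e q ▸ h).trans_lt ?_)
  refine lt_of_eq_of_lt (lintegral_congr fun r ↦ ?_) hlt
  simp only [deriv_add_const, form_apply]
  simp

/-- The height `t` is `1`-Lipschitz. -/
theorem height_le_rdist (p q : TwistedCover s) :
    ENNReal.ofReal |q.2.2 - p.2.2| ≤ rdist p q := by
  refine le_of_forall_gt fun L hL ↦ ?_
  obtain ⟨γ, h0, h1, hγ, hlt⟩ := exists_of_rdist_lt hL
  refine lt_of_le_of_lt ?_ hlt
  have hτ : ContDiffOn ℝ 1 (fun r ↦ (γ r).2.2) (Icc 0 1) := hγ.snd.snd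
  have h := enorm_sub_le_lintegral_deriv_of_contDiffOn_Icc hτ zero_le_one
  rw [h0, h1, ← ofReal_norm, Real.norm_eq_abs] at h
  refine h.trans ?_
  rw [← restrict_Ioo_eq_restrict_Icc]
  refine setLIntegral_mono' measurableSet_Ioo fun r hr ↦ ?_
  have hd : DifferentiableAt ℝ γ r :=
    ((hγ r (Ioo_subset_Icc_self hr)).contDiffAt (Icc_mem_nhds hr.1 hr.2)).differentiableAt
      one_ne_zero
  have : deriv (fun r ↦ (γ r).2.2) r = (deriv γ r).2.2 :=
    HasDerivAt.deriv hd.hasDerivAt.snd.snd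
  rw [this, ← ofReal_norm, Real.norm_eq_abs]
  refine ENNReal.ofReal_le_ofReal (Real.abs_le_sqrt ?_)
  rw [form_apply]
  have := mul_nonneg (sq_nonneg (Real.exp (γ r).2.2)) (add_nonneg
    (mul_self_nonneg ((deriv γ r).1 + s * (γ r).2.2 * (deriv γ r).2.1))
    (mul_self_nonneg (deriv γ r).2.1))
  linarith [sq (deriv γ r).2.2]

theorem rdist_vertical_le (x y a b : ℝ) :
    rdist (s := s) (x, y, a) (x, y, b) ≤ ENNReal.ofReal |b - a| := by
  let γ : ℝ → ℝ × ℝ × ℝ := fun r ↦ (x, y, a + r * (b - a))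
  have hγ : ContDiff ℝ 1 γ := by fun_prop
  have h := rdist_le (s := s) hγ.contDiffOn
  have h0 : γ 0 = (x, y, a) := by simp [γ]
  have h1 : γ 1 = (x, y, b) := by simp [γ]
  rw [h0, h1] at h
  refine h.trans (le_of_eq ?_)
  have hd (r : ℝ) : deriv γ r = (0, 0, b - a) := by
    have h3 : HasDerivAt (fun r : ℝ ↦ a + r * (b - a)) (b - a) r := by
      simpa using ((hasDerivAt_id r).mul_const (b - a)).const_add a
    exact ((hasDerivAt_const r x).prodMk ((hasDerivAt_const r y).prodMk h3)).deriv
  simp [hd, form_apply, Real.sqrt_mul_self_eq_abs]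

end TwistedCover

/-! ## The quotients by `ℤ²` -/

/-- The quotient of `TwistedCover s` by the translations by `ℤ² × 0`, i.e. `𝕋² × ℝ`. -/
def TwistedQuotient (_s : ℝ) : Type := (UnitAddCircle × UnitAddCircle) × ℝ

namespace TwistedQuotient

variable {s : ℝ}

/-- The point with torus coordinates `P` and height `t`. -/
def mk (P : UnitAddCircle × UnitAddCircle) (t : ℝ) : TwistedQuotient s := (P, t)

/-- The covering map. -/
def proj (p : TwistedCover s) : TwistedQuotient s :=
  mk ((p.1 : UnitAddCircle), (p.2.1 : UnitAddCircle)) p.2.2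

theorem proj_surjective : Function.Surjective (proj (s := s)) := by
  rintro ⟨⟨x, y⟩, t⟩
  obtain ⟨x, rfl⟩ := QuotientAddGroup.mk_surjective x
  obtain ⟨y, rfl⟩ := QuotientAddGroup.mk_surjective y
  exact ⟨(x, y, t), rfl⟩

theorem exists_translate {p q : TwistedCover s} (h : proj p = proj q) :
    ∃ a b : ℝ, q = TwistedCover.translate a b p ∧
      ∀ r : TwistedCover s, proj (TwistedCover.translate a b r) = proj r := by
  obtain ⟨h12, h3⟩ := Prod.ext_iff.1 h
  obtain ⟨h1, h2⟩ := Prod.ext_iff.1 h12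
  refine ⟨q.1 - p.1, q.2.1 - p.2.1, ?_, fun r ↦ ?_⟩
  · refine Prod.ext ?_ (Prod.ext ?_ h3.symm)
    · exact (add_sub_cancel p.1 q.1).symm
    · exact (add_sub_cancel p.2.1 q.2.1).symm
  · have h1' : (p.1 : UnitAddCircle) = (q.1 : UnitAddCircle) := h1
    have h2' : (p.2.1 : UnitAddCircle) = (q.2.1 : UnitAddCircle) := h2
    refine Prod.ext (Prod.ext ?_ ?_) rfl
    · change ((r.1 + (q.1 - p.1) : ℝ) : UnitAddCircle) = (r.1 : UnitAddCircle)
      rw [AddCircle.coe_add, AddCircle.coe_sub, h1', sub_self, add_zero]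
    · change ((r.2.1 + (q.2.1 - p.2.1) : ℝ) : UnitAddCircle) = (r.2.1 : UnitAddCircle)
      rw [AddCircle.coe_add, AddCircle.coe_sub, h2', sub_self, add_zero]

/-- The Riemannian distance of the quotient: the infimum of the lengths of `C^1` curves of
`ℝ² × ℝ` joining a lift of `P` to a lift of `Q`. -/
instance : PseudoEMetricSpace (TwistedQuotient s) where
  edist P Q := ⨅ (p : TwistedCover s) (q : TwistedCover s) (_ : proj p = P) (_ : proj q = Q),
    TwistedCover.rdist p q
  edist_self P := by
    obtain ⟨p, rfl⟩ := proj_surjective P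
    refine le_antisymm ?_ bot_le
    exact (iInf₂_le_of_le p p (iInf₂_le (by rfl) (by rfl))).trans_eq (TwistedCover.rdist_self p)
  edist_comm P Q := by
    rw [iInf_comm]
    simp only [TwistedCover.rdist_comm]
    refine iInf_congr fun p ↦ iInf_congr fun q ↦ iInf_comm
  edist_triangle P Q R := by
    refine le_of_forall_gt fun L hL ↦ ?_
    obtain ⟨u, hu, v, hv, huv⟩ := ENNReal.exists_add_lt_of_add_lt hL
    simp only [iInf_lt_iff] at hu hv
    obtain ⟨p, q, hp, hq, hpq⟩ := hu
    obtain ⟨q', r, hq', hr, hqr⟩ := hv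
    obtain ⟨a, b, hab, hT⟩ := exists_translate (hq'.trans hq.symm)
    refine lt_of_le_of_lt ?_ huv
    refine (iInf₂_le_of_le p (TwistedCover.translate a b r)
      (iInf₂_le hp ((hT r).trans hr))).trans ?_
    refine (TwistedCover.rdist_triangle p q _).trans (add_le_add hpq.le ?_)
    rw [hab]
    exact (TwistedCover.rdist_translate_le a b q' r).trans hqr.le

theorem edist_eq (P Q : TwistedQuotient s) :
    edist P Q = ⨅ (p : TwistedCover s) (q : TwistedCover s) (_ : proj p = P) (_ : proj q = Q),
      TwistedCover.rdist p q := rfl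

instance : PseudoMetricSpace (TwistedQuotient s) :=
  PseudoEMetricSpace.toPseudoMetricSpace fun P Q ↦ by
    obtain ⟨p, rfl⟩ := proj_surjective P
    obtain ⟨q, rfl⟩ := proj_surjective Q
    rw [edist_eq]
    exact ne_top_of_le_ne_top (TwistedCover.rdist_ne_top p q)
      (iInf₂_le_of_le p q (iInf₂_le (by rfl) (by rfl)))

theorem edist_vertical (P : UnitAddCircle × UnitAddCircle) (a b : ℝ) :
    edist (mk P a : TwistedQuotient s) (mk P b) = ENNReal.ofReal |b - a| := by
  rw [edist_eq]
  apply le_antisymm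
  · obtain ⟨x, y⟩ := P
    obtain ⟨x, rfl⟩ := QuotientAddGroup.mk_surjective x
    obtain ⟨y, rfl⟩ := QuotientAddGroup.mk_surjective y
    exact (iInf₂_le_of_le (x, y, a) (x, y, b) (iInf₂_le (by rfl) (by rfl))).trans
      (TwistedCover.rdist_vertical_le x y a b)
  · refine le_iInf₂ fun p q ↦ le_iInf₂ fun hp hq ↦ ?_
    have h1 : p.2.2 = a := (Prod.ext_iff.1 hp).2
    have h2 : q.2.2 = b := (Prod.ext_iff.1 hq).2
    rw [← h1, ← h2]
    exact TwistedCover.height_le_rdist p q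

/-- The base point `(0, 0, 0)`. -/
def origin (s : ℝ) : TwistedQuotient s := mk (0, 0) 0

/-- The vertical geodesic ray `t ↦ (P, t)`, `t ≥ 0`. -/
def verticalRay (s : ℝ) (P : UnitAddCircle × UnitAddCircle) : GeodesicRay (TwistedQuotient s) :=
  ⟨fun t ↦ mk P t, fun a b ↦ by
    rw [edist_vertical, edist_comm, edist_dist, NNReal.dist_eq]⟩

end TwistedQuotient

end

open Manifold Bundle MeasureTheory Set Filter
open scoped ContDiff ENNReal NNReal Topology

noncomputable section

/-! Both spaces are treated together, as the twist parameter `s ∈ [0, 1]` takes the values 0 and 1.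
The main tool is a coarse distance formula: up to an additive constant, `dist p q` is the sum of the
two heights minus `2 * m`, where `m` is the largest height, below both points, at which the torus
coordinates differ by a vector of size at most 1. The upper bound goes down to height `m`, across
and up again (`dist_le_of_close`). The lower bound holds because a curve of given length has a
lowest possible height, and horizontal motion above it counts exponentially less
(`abs_sub_le_of_curve`, `close_of_dist_lt`).

At height `m` the two horizontal metrics differ by a factor at most linear in `m`, so changing
metrics moves the critical height by only `O(log m)` (`Close.transfer`). Hence the identity of 𝕋² ×
ℝ changes distances by `O(log R)` on balls (`dist_change_le`). The boundary is the torus plus one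
cusp point, Gromov products are critical heights up to constants, and the same shift bounds the
distortion of the identity on the boundary.

Suppose a quasi-isometry existed, and let `F` be its coarse inverse, from the twisted to the
untwisted space. Vertical rays through `P` and `P + halfTurn` have uniformly separated images at
infinity (`exists_not_sameEnd`). On the other hand, in the twisted space the direction `(-T, 1)` is
cheap at height `T`. Slanting by `1 / (2 * m)` at heights `m` and `2 * m` produces horizontal
displacements that differ by exactly a half-turn. The total displacement of the image along this
path tends to 0 for a suitable `P`: vertical parts contribute exponentially little, and slanted
parts are controlled by averaging over translates, Cauchy–Schwarz and a volume count in the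
untwisted space, giving `O(√m / m)` (`exists_sameEnd`). The two statements contradict each other. -/

/-! ### Upper and lower bounds for the Riemannian distance on the cover -/

/-- A function whose speed is small away from the lowest possible height of a curve of length `L`
has bounded variation along that curve. -/
theorem abs_sub_le_of_curve {S τ X τ' X' : ℝ → ℝ} {L m : ℝ} (hS : Continuous S)
    (hL : ∫ r in (0 : ℝ)..1, S r ≤ L) (hτc : ContinuousOn τ (Icc 0 1))
    (hXc : ContinuousOn X (Icc 0 1)) (hτ : ∀ r ∈ Ioo (0 : ℝ) 1, HasDerivAt τ (τ' r) r)
    (hX : ∀ r ∈ Ioo (0 : ℝ) 1, HasDerivAt X (X' r) r)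
    (hτS : ∀ r ∈ Ioo (0 : ℝ) 1, |τ' r| ≤ S r) (hm : m = (τ 0 + τ 1 - L) / 2)
    (hXS : ∀ r ∈ Ioo (0 : ℝ) 1, m ≤ τ r → |X' r| ≤ 2 * Real.exp (-(τ r - m) / 2) * S r) :
    |X 1 - X 0| ≤ 13 := by
  have mono {f f' : ℝ → ℝ} (hc : ContinuousOn f (Icc 0 1))
      (hf : ∀ r ∈ Ioo (0 : ℝ) 1, HasDerivAt f (f' r) r) (h0 : ∀ r ∈ Ioo (0 : ℝ) 1, 0 ≤ f' r) :
      MonotoneOn f (Icc 0 1) := by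
    refine monotoneOn_of_deriv_nonneg (convex_Icc 0 1) hc ?_ ?_ <;> rw [interior_Icc]
    · exact fun r hr ↦ (hf r hr).differentiableAt.differentiableWithinAt
    · exact fun r hr ↦ (hf r hr).deriv ▸ h0 r hr
  set l : ℝ → ℝ := fun r ↦ ∫ u in (0 : ℝ)..r, S u with hl
  have hld (r : ℝ) : HasDerivAt l (S r) r := (hS.integral_hasStrictDerivAt 0 r).hasDerivAt
  have hlc : Continuous l := continuous_iff_continuousAt.2 fun r ↦ (hld r).continuousAt
  have hl0 : l 0 = 0 := by simp [hl]
  have m1 : MonotoneOn (fun r ↦ l r + τ r) (Icc 0 1) :=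
    mono (hlc.continuousOn.add hτc) (fun r hr ↦ (hld r).add (hτ r hr))
      fun r hr ↦ by linarith [neg_le_of_abs_le (hτS r hr)]
  have m2 : MonotoneOn (fun r ↦ l r - τ r) (Icc 0 1) :=
    mono (hlc.continuousOn.sub hτc) (fun r hr ↦ (hld r).sub (hτ r hr))
      fun r hr ↦ by linarith [le_of_abs_le (hτS r hr)]
  -- Arc length, measured from the moment at which a curve descending from `τ 0` at unit speed would
  -- reach height `m`. Since height is 1-Lipschitz in arc length, the curve is at height at least `m
  -- + |u|`.
  set u : ℝ → ℝ := fun r ↦ l r - (L + τ 0 - τ 1) / 2 with hu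
  have hut (r : ℝ) (hr : r ∈ Icc (0 : ℝ) 1) : |u r| ≤ τ r - m := by
    have h1 := m1 (left_mem_Icc.2 zero_le_one) hr hr.1
    have h2 := m2 hr (right_mem_Icc.2 zero_le_one) hr.2
    simp only [hl0] at h1 h2
    have h3 : l 1 ≤ L := hL
    rw [abs_le]
    constructor <;> simp only [hu, hm] <;> linarith
  -- A smooth primitive of a majorant of `2 * exp (-|u| / 2)`, avoiding the corner at `u = 0`. Its
  -- total variation is at most `8 * (π / 2) = 4π < 13`.
  set Ψ : ℝ → ℝ := fun r ↦ 8 * Real.arctan (Real.exp (u r / 2)) with hΨ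
  have hud (r : ℝ) : HasDerivAt u (S r) r := (hld r).sub_const _
  have hΨd (r : ℝ) : HasDerivAt Ψ
      (8 * (1 / (1 + Real.exp (u r / 2) ^ 2) * (Real.exp (u r / 2) * (S r / 2)))) r :=
    (((hud r).div_const 2).exp.arctan).const_mul 8
  have hΨc : Continuous Ψ := continuous_iff_continuousAt.2 fun r ↦ (hΨd r).continuousAt
  have key (r : ℝ) (hr : r ∈ Ioo (0 : ℝ) 1) :
      |X' r| ≤ 8 * (1 / (1 + Real.exp (u r / 2) ^ 2) * (Real.exp (u r / 2) * (S r / 2))) := by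
    have h1 := hut r (Ioo_subset_Icc_self hr)
    have h2 := hXS r hr (by linarith [abs_nonneg (u r)])
    have hS0 : 0 ≤ S r := (abs_nonneg _).trans (hτS r hr)
    refine h2.trans ?_
    have h3 : Real.exp (-(τ r - m) / 2) ≤ Real.exp (-|u r| / 2) :=
      Real.exp_le_exp.2 (by linarith)
    set e := Real.exp (u r / 2) with he
    have he0 : 0 < e := Real.exp_pos _
    have h4 : Real.exp (-|u r| / 2) ≤ 2 * (e / (1 + e ^ 2)) := by
      rw [← mul_div_assoc, le_div_iff₀ (by positivity)]
      rcases le_total 0 (u r) with h | h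
      · have h5 : Real.exp (-|u r| / 2) = e⁻¹ := by
          rw [abs_of_nonneg h, he, ← Real.exp_neg]; ring_nf
        have h6 : 1 ≤ e := Real.one_le_exp (by linarith)
        have h7 : e⁻¹ * e = 1 := inv_mul_cancel₀ he0.ne'
        have h8 : e⁻¹ ≤ 1 := inv_le_one_of_one_le₀ h6
        rw [h5]
        calc e⁻¹ * (1 + e ^ 2) = e⁻¹ + (e⁻¹ * e) * e := by ring
          _ ≤ 2 * e := by rw [h7]; linarith
      · have h5 : Real.exp (-|u r| / 2) = e := by
          rw [abs_of_nonpos h, he]; ring_nf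
        have h6 : e ≤ 1 := Real.exp_le_one_iff.2 (by linarith)
        rw [h5]
        nlinarith
    calc 2 * Real.exp (-(τ r - m) / 2) * S r ≤ 2 * (2 * (e / (1 + e ^ 2))) * S r := by
          gcongr; exact h3.trans h4
      _ = _ := by ring
  have m3 : MonotoneOn (fun r ↦ Ψ r - X r) (Icc 0 1) :=
    mono (hΨc.continuousOn.sub hXc) (fun r hr ↦ (hΨd r).sub (hX r hr))
      fun r hr ↦ by linarith [le_of_abs_le (key r hr)]
  have m4 : MonotoneOn (fun r ↦ Ψ r + X r) (Icc 0 1) :=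
    mono (hΨc.continuousOn.add hXc) (fun r hr ↦ (hΨd r).add (hX r hr))
      fun r hr ↦ by linarith [neg_le_of_abs_le (key r hr)]
  have h3 := m3 (left_mem_Icc.2 zero_le_one) (right_mem_Icc.2 zero_le_one) zero_le_one
  have h4 := m4 (left_mem_Icc.2 zero_le_one) (right_mem_Icc.2 zero_le_one) zero_le_one
  have h5 : Ψ 1 - Ψ 0 ≤ 13 := by
    have k1 := Real.arctan_lt_pi_div_two (Real.exp (u 1 / 2))
    have k2 := Real.arctan_pos.2 (Real.exp_pos (u 0 / 2))
    have k3 := Real.pi_lt_d2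
    simp only [hΨ]
    linarith
  simp only at h3 h4
  rw [abs_le]
  constructor <;> linarith

theorem one_add_le_two_mul_exp_half (u : ℝ) : 1 + u ≤ 2 * Real.exp (u / 2) := by
  linarith [Real.add_one_le_exp (u / 2)]

/-- The shear by `s * t` changes slowly compared with `exp t`. -/
theorem exp_mul_abs_shear_le {s t m a b A : ℝ} (hs0 : 0 ≤ s) (hs1 : s ≤ 1) (hmt : m ≤ t)
    (h1 : Real.exp t * |a + s * t * b| ≤ A) (h2 : Real.exp t * |b| ≤ A) :
    Real.exp m * |a + s * m * b| ≤ (1 + (t - m)) * Real.exp (-(t - m)) * A ∧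
      Real.exp m * |b| ≤ (1 + (t - m)) * Real.exp (-(t - m)) * A := by
  have e : Real.exp m = Real.exp (-(t - m)) * Real.exp t := by rw [← Real.exp_add]; ring_nf
  have h0 : 0 ≤ t - m := sub_nonneg.2 hmt
  have hA : 0 ≤ A := le_trans (by positivity) h2
  constructor
  · have h3 : |a + s * m * b| ≤ |a + s * t * b| + (t - m) * |b| := by
      calc |a + s * m * b| = |(a + s * t * b) - s * ((t - m) * b)| := by ring_nf
        _ ≤ |a + s * t * b| + |s * ((t - m) * b)| := abs_sub _ _
        _ ≤ |a + s * t * b| + (t - m) * |b| := by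
          rw [abs_mul, abs_mul, abs_of_nonneg hs0, abs_of_nonneg h0]
          refine add_le_add_right ?_ _
          exact mul_le_of_le_one_left (mul_nonneg h0 (abs_nonneg b)) hs1
    calc Real.exp m * |a + s * m * b|
        ≤ Real.exp (-(t - m)) * Real.exp t * (|a + s * t * b| + (t - m) * |b|) := by
          rw [e]; gcongr
      _ = Real.exp (-(t - m)) * (Real.exp t * |a + s * t * b| +
            (t - m) * (Real.exp t * |b|)) := by ring
      _ ≤ Real.exp (-(t - m)) * (A + (t - m) * A) := by gcongr
      _ = _ := by ring
  · calc Real.exp m * |b| = Real.exp (-(t - m)) * (Real.exp t * |b|) := by rw [e]; ring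
      _ ≤ Real.exp (-(t - m)) * A := by gcongr
      _ ≤ _ := by
        rw [mul_assoc]
        exact le_mul_of_one_le_left (by positivity) (by linarith)

/-- The linear factor caused by the shear is absorbed by giving up half of the exponential decay. -/
theorem one_add_mul_exp_neg_le (u : ℝ) :
    (1 + u) * Real.exp (-u) ≤ 2 * Real.exp (-u / 2) := by
  calc (1 + u) * Real.exp (-u) ≤ 2 * Real.exp (u / 2) * Real.exp (-u) := by
        gcongr; exact one_add_le_two_mul_exp_half u
    _ = 2 * Real.exp (-u / 2) := by rw [mul_assoc, ← Real.exp_add]; ring_nf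

namespace TwistedCover

variable {s : ℝ}

theorem rdist_horizontal_le (x y x' y' m : ℝ) :
    rdist (s := s) (x, y, m) (x', y', m) ≤
      ENNReal.ofReal (Real.exp m * |x' - x + s * m * (y' - y)| + Real.exp m * |y' - y|) := by
  let γ : ℝ → ℝ × ℝ × ℝ := fun r ↦ (x + r * (x' - x), y + r * (y' - y), m)
  have hγ : ContDiff ℝ 1 γ := by fun_prop
  have h := rdist_le (s := s) hγ.contDiffOn
  have h0 : γ 0 = (x, y, m) := by simp [γ]
  have h1 : γ 1 = (x', y', m) := by simp [γ]
  rw [h0, h1] at h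
  refine h.trans ?_
  have hd (r : ℝ) : deriv γ r = (x' - x, y' - y, 0) := by
    have h3 (a b : ℝ) : HasDerivAt (fun r : ℝ ↦ a + r * (b - a)) (b - a) r := by
      simpa using ((hasDerivAt_id r).mul_const (b - a)).const_add a
    exact ((h3 x x').prodMk ((h3 y y').prodMk (hasDerivAt_const r m))).deriv
  have hb (r : ℝ) : ENNReal.ofReal √(form s (γ r) (deriv γ r) (deriv γ r)) ≤
      ENNReal.ofReal (Real.exp m * |x' - x + s * m * (y' - y)| + Real.exp m * |y' - y|) := by
    refine ENNReal.ofReal_le_ofReal (Real.sqrt_le_iff.2 ⟨by positivity, ?_⟩)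
    rw [hd, form_apply]
    simp only [γ]
    have k1 := sq_abs (x' - x + s * m * (y' - y))
    have k2 := sq_abs (y' - y)
    have k3 : 0 ≤ Real.exp m ^ 2 * (|x' - x + s * m * (y' - y)| * |y' - y|) := by positivity
    calc _ = Real.exp m ^ 2 * ((x' - x + s * m * (y' - y)) ^ 2 + (y' - y) ^ 2) := by ring
      _ = Real.exp m ^ 2 * (|x' - x + s * m * (y' - y)| ^ 2 + |y' - y| ^ 2) := by rw [k1, k2]
      _ ≤ _ := by linarith
  calc _ ≤ ∫⁻ _ in Icc (0 : ℝ) 1,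
        ENNReal.ofReal (Real.exp m * |x' - x + s * m * (y' - y)| + Real.exp m * |y' - y|) :=
        lintegral_mono hb
    _ = _ := by simp

/-- Going down to height `m`, then horizontally, then up again. -/
theorem rdist_le_of_le_height (p q : TwistedCover s) {m : ℝ} (hp : m ≤ p.2.2) (hq : m ≤ q.2.2) :
    rdist p q ≤ ENNReal.ofReal (p.2.2 + q.2.2 - 2 * m +
      (Real.exp m * |q.1 - p.1 + s * m * (q.2.1 - p.2.1)| + Real.exp m * |q.2.1 - p.2.1|)) := by
  have h1 := rdist_vertical_le (s := s) p.1 p.2.1 p.2.2 m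
  have h2 := rdist_horizontal_le (s := s) p.1 p.2.1 q.1 q.2.1 m
  have h3 := rdist_vertical_le (s := s) q.1 q.2.1 m q.2.2
  rw [abs_sub_comm, abs_of_nonneg (sub_nonneg.2 hp)] at h1
  rw [abs_of_nonneg (sub_nonneg.2 hq)] at h3
  refine (rdist_triangle p _ q).trans ((add_le_add h1
    ((rdist_triangle _ _ q).trans (add_le_add h2 h3))).trans (le_of_eq ?_))
  rw [← ENNReal.ofReal_add (by positivity) (by linarith), ← ENNReal.ofReal_add (by linarith)
    (add_nonneg (by positivity) (by linarith))]
  congr 1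
  ring

theorem abs_le_sqrt_form (p v : ℝ × ℝ × ℝ) :
    |v.2.2| ≤ √(form s p v v) ∧
      Real.exp p.2.2 * |v.1 + s * p.2.2 * v.2.1| ≤ √(form s p v v) ∧
      Real.exp p.2.2 * |v.2.1| ≤ √(form s p v v) := by
  have e : 0 < Real.exp p.2.2 := Real.exp_pos _
  have k1 := sq_nonneg v.2.2
  have k2 := sq_nonneg (Real.exp p.2.2 * (v.1 + s * p.2.2 * v.2.1))
  have k3 := sq_nonneg (Real.exp p.2.2 * v.2.1)
  have hf : form s p v v = v.2.2 ^ 2 + (Real.exp p.2.2 * (v.1 + s * p.2.2 * v.2.1)) ^ 2 +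
      (Real.exp p.2.2 * v.2.1) ^ 2 := by rw [form_apply]; ring
  refine ⟨Real.abs_le_sqrt (by linarith), ?_, ?_⟩
  · have := Real.abs_le_sqrt (x := Real.exp p.2.2 * (v.1 + s * p.2.2 * v.2.1))
      (y := form s p v v) (by linarith)
    rwa [abs_mul, abs_of_pos e] at this
  · have := Real.abs_le_sqrt (x := Real.exp p.2.2 * v.2.1) (y := form s p v v) (by linarith)
    rwa [abs_mul, abs_of_pos e] at this

/-- Lower bound for the distance: points at distance less than `L` are horizontally close at the
lowest height that a curve of length `L` can reach. -/
theorem horizontal_le_of_rdist_lt (hs0 : 0 ≤ s) (hs1 : s ≤ 1) {p q : TwistedCover s} {L m : ℝ}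
    (h : rdist p q < ENNReal.ofReal L) (hm : m = (p.2.2 + q.2.2 - L) / 2) :
    Real.exp m * |q.1 - p.1 + s * m * (q.2.1 - p.2.1)| ≤ 13 ∧
      Real.exp m * |q.2.1 - p.2.1| ≤ 13 := by
  obtain ⟨γ, h0, h1, hγ, hlt⟩ := exists_of_rdist_lt h
  set D : ℝ → ℝ × ℝ × ℝ := derivWithin γ (Icc 0 1) with hD
  have hDc : ContinuousOn D (Icc 0 1) :=
    hγ.continuousOn_derivWithin (uniqueDiffOn_Icc zero_lt_one) le_rfl
  have hγc : ContinuousOn γ (Icc 0 1) := hγ.continuousOn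
  set σ : ℝ → ℝ := fun r ↦ √(form s (γ r) (D r) (D r)) with hσ
  have hσc : ContinuousOn σ (Icc 0 1) := by
    simp only [hσ, form_apply]
    fun_prop
  -- The curve is only `C^1` on the unit interval, so its speed is extended by constants to a
  -- continuous function on the line, which makes its integral differentiable everywhere.
  set S : ℝ → ℝ := IccExtend (zero_le_one' ℝ) ((Icc 0 1).domRestrict σ) with hS
  have hSc : Continuous S := (continuousOn_iff_continuous_domRestrict.1 hσc).Icc_extend'
  have hSσ (r : ℝ) (hr : r ∈ Icc (0 : ℝ) 1) : S r = σ r := by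
    rw [hS, IccExtend_of_mem _ _ hr]; rfl
  have hd (r : ℝ) (hr : r ∈ Ioo (0 : ℝ) 1) : HasDerivAt γ (D r) r := by
    have := ((hγ r (Ioo_subset_Icc_self hr)).differentiableWithinAt one_ne_zero)
    exact this.hasDerivWithinAt.hasDerivAt (Icc_mem_nhds hr.1 hr.2)
  have hd1 (r : ℝ) (hr : r ∈ Ioo (0 : ℝ) 1) : HasDerivAt (fun r ↦ (γ r).1) (D r).1 r :=
    (hd r hr).fst
  have hd2 (r : ℝ) (hr : r ∈ Ioo (0 : ℝ) 1) : HasDerivAt (fun r ↦ (γ r).2.1) (D r).2.1 r :=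
    (hd r hr).snd.fst
  have hL : ∫ r in (0 : ℝ)..1, S r ≤ L := by
    have h2 : ENNReal.ofReal (∫ r in (0 : ℝ)..1, S r) < ENNReal.ofReal L := by
      rw [intervalIntegral.integral_of_le zero_le_one, ← integral_Icc_eq_integral_Ioc,
        ofReal_integral_eq_lintegral_ofReal hSc.integrableOn_Icc]
      · refine lt_of_eq_of_lt ?_ hlt
        rw [← restrict_Ioo_eq_restrict_Icc]
        refine setLIntegral_congr_fun measurableSet_Ioo fun r hr ↦ ?_
        rw [hSσ r (Ioo_subset_Icc_self hr), (hd r hr).deriv]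
      · refine (ae_restrict_iff' measurableSet_Icc).2 (ae_of_all _ fun r hr ↦ ?_)
        rw [hSσ r hr]
        exact Real.sqrt_nonneg _
    exact (ENNReal.ofReal_lt_ofReal_iff_of_nonneg (intervalIntegral.integral_nonneg zero_le_one
      fun r hr ↦ by rw [hSσ r hr]; exact Real.sqrt_nonneg _)).1 h2 |>.le
  have hp : (γ 0).1 = p.1 ∧ (γ 0).2.1 = p.2.1 ∧ (γ 0).2.2 = p.2.2 := by rw [h0]; simp
  have hq : (γ 1).1 = q.1 ∧ (γ 1).2.1 = q.2.1 ∧ (γ 1).2.2 = q.2.2 := by rw [h1]; simp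
  have bnd (r : ℝ) (hr : r ∈ Ioo (0 : ℝ) 1) := abs_le_sqrt_form (s := s) (γ r) (D r)
  have bnd' (r : ℝ) (hr : r ∈ Ioo (0 : ℝ) 1) (hmr : m ≤ (γ r).2.2) :
      Real.exp m * |(D r).1 + s * m * (D r).2.1| ≤
        2 * Real.exp (-((γ r).2.2 - m) / 2) * S r ∧
      Real.exp m * |(D r).2.1| ≤ 2 * Real.exp (-((γ r).2.2 - m) / 2) * S r := by
    have k := exp_mul_abs_shear_le hs0 hs1 hmr (bnd r hr).2.1 (bnd r hr).2.2
    have k2 := mul_le_mul_of_nonneg_right (one_add_mul_exp_neg_le ((γ r).2.2 - m))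
      (Real.sqrt_nonneg (form s (γ r) (D r) (D r)))
    rw [hSσ r (Ioo_subset_Icc_self hr)]
    exact ⟨k.1.trans k2, k.2.trans k2⟩
  have hm' : m = ((γ 0).2.2 + (γ 1).2.2 - L) / 2 := by rw [hm, hp.2.2, hq.2.2]
  have e : 0 < Real.exp m := Real.exp_pos _
  constructor
  · have k := abs_sub_le_of_curve (τ := fun r ↦ (γ r).2.2) (τ' := fun r ↦ (D r).2.2)
      (X := fun r ↦ Real.exp m * ((γ r).1 + s * m * (γ r).2.1))
      (X' := fun r ↦ Real.exp m * ((D r).1 + s * m * (D r).2.1)) hSc hL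
      (by fun_prop) (by fun_prop) (fun r hr ↦ (hd r hr).snd.snd)
      (fun r hr ↦ ((hd1 r hr).add ((hd2 r hr).const_mul _)).const_mul _)
      (fun r hr ↦ by rw [hSσ r (Ioo_subset_Icc_self hr)]; exact (bnd r hr).1) hm'
      (fun r hr hmr ↦ by rw [abs_mul, abs_of_pos e]; exact (bnd' r hr hmr).1)
    rw [← mul_sub, abs_mul, abs_of_pos e] at k
    rw [hp.1, hp.2.1, hq.1, hq.2.1] at k
    have e2 : q.1 + s * m * q.2.1 - (p.1 + s * m * p.2.1) =
      q.1 - p.1 + s * m * (q.2.1 - p.2.1) := by ring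
    rwa [e2] at k
  · have k := abs_sub_le_of_curve (τ := fun r ↦ (γ r).2.2) (τ' := fun r ↦ (D r).2.2)
      (X := fun r ↦ Real.exp m * (γ r).2.1)
      (X' := fun r ↦ Real.exp m * (D r).2.1) hSc hL
      (by fun_prop) (by fun_prop) (fun r hr ↦ (hd r hr).snd.snd)
      (fun r hr ↦ (hd2 r hr).const_mul _)
      (fun r hr ↦ by rw [hSσ r (Ioo_subset_Icc_self hr)]; exact (bnd r hr).1) hm'
      (fun r hr hmr ↦ by rw [abs_mul, abs_of_pos e]; exact (bnd' r hr hmr).2)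
    rw [← mul_sub, abs_mul, abs_of_pos e] at k
    rwa [hp.2.1, hq.2.1] at k

end TwistedCover

/-! ### Closeness of torus points and the coarse distance formula -/

namespace TwistedQuotient

variable {s : ℝ}

/-- The torus coordinates of a point. -/
def torus (p : TwistedQuotient s) : UnitAddCircle × UnitAddCircle := p.1

/-- The height of a point. -/
def height (p : TwistedQuotient s) : ℝ := p.2

@[simp] theorem torus_mk (P : UnitAddCircle × UnitAddCircle) (t : ℝ) :
    (mk P t : TwistedQuotient s).torus = P := rfl

@[simp] theorem height_mk (P : UnitAddCircle × UnitAddCircle) (t : ℝ) :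
    (mk P t : TwistedQuotient s).height = t := rfl

theorem dist_vertical (P : UnitAddCircle × UnitAddCircle) (a b : ℝ) :
    dist (mk P a : TwistedQuotient s) (mk P b) = |b - a| := by
  have h := edist_vertical (s := s) P a b
  rw [edist_dist] at h
  exact (ENNReal.ofReal_eq_ofReal_iff dist_nonneg (abs_nonneg _)).1 h

theorem abs_height_sub_le_dist (p q : TwistedQuotient s) :
    |q.height - p.height| ≤ dist p q := by
  refine (ENNReal.ofReal_le_ofReal_iff dist_nonneg).1 ?_
  rw [← edist_dist, edist_eq]
  refine le_iInf₂ fun p' q' ↦ le_iInf₂ fun hp hq ↦ ?_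
  have h1 : p'.2.2 = p.height := (Prod.ext_iff.1 hp).2
  have h2 : q'.2.2 = q.height := (Prod.ext_iff.1 hq).2
  rw [← h1, ← h2]
  exact TwistedCover.height_le_rdist p' q'

/-- The torus points `P` and `Q` differ by a vector of size at most `k` for the metric at
height `m`. -/
def Close (s k m : ℝ) (P Q : UnitAddCircle × UnitAddCircle) : Prop :=
  ∃ x y : ℝ, Q - P = ((x : UnitAddCircle), (y : UnitAddCircle)) ∧
    Real.exp m * |x + s * m * y| ≤ k ∧ Real.exp m * |y| ≤ k

namespace Close

variable {k k' m m' u : ℝ} {P Q W : UnitAddCircle × UnitAddCircle}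

theorem mono_right (h : Close s k m P Q) (hk : k ≤ k') : Close s k' m P Q :=
  let ⟨x, y, hxy, h1, h2⟩ := h
  ⟨x, y, hxy, h1.trans hk, h2.trans hk⟩

theorem symm (h : Close s k m P Q) : Close s k m Q P := by
  obtain ⟨x, y, hxy, h1, h2⟩ := h
  refine ⟨-x, -y, ?_, ?_, by rwa [abs_neg]⟩
  · rw [← neg_sub, hxy]; rfl
  · rwa [show -x + s * m * -y = -(x + s * m * y) by ring, abs_neg]

theorem trans (h : Close s k m P Q) (h' : Close s k' m Q W) : Close s (k + k') m P W := by
  obtain ⟨x, y, hxy, h1, h2⟩ := h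
  obtain ⟨x', y', hxy', h1', h2'⟩ := h'
  refine ⟨x + x', y + y', ?_, ?_, ?_⟩
  · rw [← sub_add_sub_cancel' Q P W, hxy, hxy', AddCircle.coe_add, AddCircle.coe_add,
      Prod.mk_add_mk]
  · calc _ = Real.exp m * |(x + s * m * y) + (x' + s * m * y')| := by ring_nf
      _ ≤ Real.exp m * (|x + s * m * y| + |x' + s * m * y'|) := by gcongr; exact abs_add_le _ _
      _ ≤ _ := by rw [mul_add]; exact add_le_add h1 h1'
  · calc _ ≤ Real.exp m * (|y| + |y'|) := by gcongr; exact abs_add_le _ _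
      _ ≤ _ := by rw [mul_add]; exact add_le_add h2 h2'

/-- Descending by `u` shrinks horizontal vectors by `exp (-u)` while the shear grows them by at most
`1 + u`. -/
theorem lower (hs0 : 0 ≤ s) (hs1 : s ≤ 1) (h : Close s k m P Q) (hu : 0 ≤ u) :
    Close s (2 * k * Real.exp (-u / 2)) (m - u) P Q := by
  obtain ⟨x, y, hxy, h1, h2⟩ := h
  have h3 := exp_mul_abs_shear_le hs0 hs1 (sub_le_self m hu) h1 h2
  rw [sub_sub_cancel] at h3
  have hk : 0 ≤ k := le_trans (by positivity) h2
  have h4 : (1 + u) * Real.exp (-u) * k ≤ 2 * k * Real.exp (-u / 2) := by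
    have := mul_le_mul_of_nonneg_right (one_add_mul_exp_neg_le u) hk
    linarith
  exact ⟨x, y, hxy, h3.1.trans h4, h3.2.trans h4⟩

/-- No constant is lost, because `(1 + u) * exp (-u) ≤ 1`. -/
theorem mono (hs0 : 0 ≤ s) (hs1 : s ≤ 1) (h : Close s k m P Q) (hm : m' ≤ m) :
    Close s k m' P Q := by
  obtain ⟨x, y, hxy, h1, h2⟩ := h
  have h3 := exp_mul_abs_shear_le hs0 hs1 hm h1 h2
  have hk : 0 ≤ k := le_trans (by positivity) h2
  have h4 : (1 + (m - m')) * Real.exp (-(m - m')) * k ≤ k := by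
    refine mul_le_of_le_one_left hk ?_
    calc (1 + (m - m')) * Real.exp (-(m - m'))
        ≤ Real.exp (m - m') * Real.exp (-(m - m')) := by
          gcongr; linarith [Real.add_one_le_exp (m - m')]
      _ = 1 := by rw [← Real.exp_add]; simp
  exact ⟨x, y, hxy, h3.1.trans h4, h3.2.trans h4⟩

/-- Normalises the size bound to 1 at the price of height: a factor `k` costs about `2 * log (2 *
k)`. All later constants and logarithms arise in this way. -/
theorem to_one (hs0 : 0 ≤ s) (hs1 : s ≤ 1) (h : Close s k m P Q) (hu : 0 ≤ u)
    (hk : 2 * k ≤ Real.exp (u / 2)) : Close s 1 (m - u) P Q := by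
  refine (h.lower hs0 hs1 hu).mono_right ?_
  calc 2 * k * Real.exp (-u / 2) ≤ Real.exp (u / 2) * Real.exp (-u / 2) := by gcongr
    _ = 1 := by rw [← Real.exp_add]; ring_nf; simp

theorem trans_one (hs0 : 0 ≤ s) (hs1 : s ≤ 1) (h : Close s 1 m P Q) (h' : Close s 1 m Q W) :
    Close s 1 (m - 4) P W := by
  refine (h.trans h').to_one hs0 hs1 (by norm_num) ?_
  have : (2 : ℝ) ≤ Real.exp 1 := by linarith [Real.add_one_le_exp (1 : ℝ)]
  rw [show (4 : ℝ) / 2 = 1 + 1 by norm_num, Real.exp_add]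
  nlinarith

end Close

theorem close_zero_of_dist_le {P Q : UnitAddCircle × UnitAddCircle} {k : ℝ} (h : dist P Q ≤ k) :
    ∃ x y : ℝ, Q - P = ((x : UnitAddCircle), (y : UnitAddCircle)) ∧ |x| ≤ k ∧ |y| ≤ k := by
  have key (z : UnitAddCircle) : ∃ x : ℝ, (x : UnitAddCircle) = z ∧ |x| = ‖z‖ := by
    obtain ⟨x, rfl⟩ := QuotientAddGroup.mk_surjective z
    refine ⟨x - round x, ?_, ?_⟩
    · have : ((round x : ℝ) : UnitAddCircle) = 0 := by
        exact (AddCircle.coe_eq_zero_iff (1 : ℝ)).2 ⟨round x, by simp⟩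
      rw [AddCircle.coe_sub, this, sub_zero]
    · exact (UnitAddCircle.norm_eq (x := x)).symm
  obtain ⟨x, hx, hx'⟩ := key (Q - P).1
  obtain ⟨y, hy, hy'⟩ := key (Q - P).2
  rw [dist_comm, dist_eq_norm, Prod.norm_def, max_le_iff] at h
  exact ⟨x, y, Prod.ext hx.symm hy.symm, hx'.trans_le h.1, hy'.trans_le h.2⟩

theorem dist_le_of_coe {P Q : UnitAddCircle × UnitAddCircle} {k x y : ℝ}
    (h : Q - P = ((x : UnitAddCircle), (y : UnitAddCircle))) (hx : |x| ≤ k) (hy : |y| ≤ k) :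
    dist P Q ≤ k := by
  have key (x : ℝ) : ‖(x : UnitAddCircle)‖ ≤ |x| := by
    rw [UnitAddCircle.norm_eq]
    simpa using round_le x 0
  rw [dist_comm, dist_eq_norm, h, Prod.norm_def]
  exact max_le ((key x).trans hx) ((key y).trans hy)

theorem close_zero_iff {k m : ℝ} {P Q : UnitAddCircle × UnitAddCircle} :
    Close 0 k m P Q ↔ Real.exp m * dist P Q ≤ k := by
  have e : 0 < Real.exp m := Real.exp_pos m
  constructor
  · rintro ⟨x, y, hxy, h1, h2⟩
    rw [← le_div_iff₀' e] at h1 h2 ⊢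
    exact dist_le_of_coe hxy (by simpa using h1) h2
  · intro h
    rw [← le_div_iff₀' e] at h
    obtain ⟨x, y, hxy, h1, h2⟩ := close_zero_of_dist_le h
    rw [le_div_iff₀' e] at h1 h2
    exact ⟨x, y, hxy, by simpa using h1, h2⟩

theorem close_at_zero_iff {k : ℝ} {P Q : UnitAddCircle × UnitAddCircle} :
    Close s k 0 P Q ↔ dist P Q ≤ k := by
  have : Close s k 0 P Q ↔ Close 0 k 0 P Q := by simp [Close]
  rw [this, close_zero_iff]
  simp

/-- At height 0 the shear vanishes and the torus has diameter at most 1; below, everything is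
smaller still. -/
theorem close_of_nonpos (hs0 : 0 ≤ s) (hs1 : s ≤ 1) {m : ℝ} (hm : m ≤ 0)
    (P Q : UnitAddCircle × UnitAddCircle) : Close s 1 m P Q := by
  refine Close.mono hs0 hs1 (close_at_zero_iff.2 ?_) hm
  rw [dist_eq_norm, Prod.norm_def]
  have key (z : UnitAddCircle) : ‖z‖ ≤ 1 :=
    (AddCircle.norm_le_half_period 1 one_ne_zero).trans (by norm_num)
  exact max_le (key _) (key _)

theorem Close.refl (m : ℝ) (P : UnitAddCircle × UnitAddCircle) : Close s 1 m P P :=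
  ⟨0, 0, by rw [sub_self]; rfl, by simp, by simp⟩

theorem Close.dist_le (hs0 : 0 ≤ s) (hs1 : s ≤ 1) {m : ℝ} (hm : 0 ≤ m)
    {P Q : UnitAddCircle × UnitAddCircle} (h : Close s 1 m P Q) :
    dist P Q ≤ 2 * Real.exp (-m / 2) := by
  have := h.lower hs0 hs1 hm
  rwa [sub_self, close_at_zero_iff, mul_one] at this

theorem close_of_dist_le (hs0 : 0 ≤ s) (hs1 : s ≤ 1) {m d : ℝ} (hm : 0 ≤ m)
    {P Q : UnitAddCircle × UnitAddCircle} (h : dist P Q ≤ d) :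
    Close s (Real.exp m * (1 + m) * d) m P Q := by
  obtain ⟨x, y, hxy, h1, h2⟩ := close_zero_of_dist_le h
  have hd : 0 ≤ d := dist_nonneg.trans h
  refine ⟨x, y, hxy, ?_, ?_⟩ <;> rw [mul_assoc (Real.exp m)] <;>
    refine mul_le_mul_of_nonneg_left ?_ (Real.exp_pos m).le
  · calc |x + s * m * y| ≤ |x| + |s * m * y| := abs_add_le _ _
      _ ≤ |x| + 1 * m * |y| := by
        rw [abs_mul, abs_mul, abs_of_nonneg hs0, abs_of_nonneg hm]
        gcongr
      _ ≤ d + 1 * m * d := by gcongr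
      _ = _ := by ring
  · exact h2.trans (le_mul_of_one_le_left hd (by linarith))

/-- This is the origin of all logarithms in the theorem: changing the twist adds a multiple of `m *
y` to the first coordinate, so size 1 becomes size at most `1 + m`, which is renormalised by
`Close.to_one`. -/
theorem Close.transfer {s' m : ℝ} (hs0 : 0 ≤ s) (hs1 : s ≤ 1) (hs0' : 0 ≤ s') (hs1' : s' ≤ 1)
    (hm : 0 ≤ m) {P Q : UnitAddCircle × UnitAddCircle} (h : Close s 1 m P Q) :
    Close s' 1 (m - 2 * Real.log (2 + 2 * m)) P Q := by
  obtain ⟨x, y, hxy, h1, h2⟩ := h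
  have h3 : Close s' (1 + m) m P Q := by
    refine ⟨x, y, hxy, ?_, by linarith⟩
    have h4 : |x + s' * m * y| ≤ |x + s * m * y| + m * |y| := by
      calc |x + s' * m * y| = |(x + s * m * y) + (s' - s) * (m * y)| := by ring_nf
        _ ≤ |x + s * m * y| + |(s' - s) * (m * y)| := abs_add_le _ _
        _ ≤ |x + s * m * y| + m * |y| := by
          rw [abs_mul, abs_mul, abs_of_nonneg hm]
          refine add_le_add_right (mul_le_of_le_one_left (by positivity) ?_) _
          exact abs_sub_le_iff.2 ⟨by linarith, by linarith⟩
    calc Real.exp m * |x + s' * m * y| ≤ Real.exp m * (|x + s * m * y| + m * |y|) := by gcongr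
      _ = Real.exp m * |x + s * m * y| + m * (Real.exp m * |y|) := by ring
      _ ≤ 1 + m * 1 := by gcongr
      _ = 1 + m := by ring
  refine h3.to_one hs0' hs1' (mul_nonneg zero_le_two (Real.log_nonneg (by linarith))) ?_
  rw [mul_div_cancel_left₀ _ (two_ne_zero' ℝ), Real.exp_log (by linarith)]
  linarith

/-- The lower half of the coarse distance formula. The variation bound 13 is turned into 1 by
descending 7, since `2 * 13 ≤ exp (7 / 2)`. -/
theorem close_of_dist_lt (hs0 : 0 ≤ s) (hs1 : s ≤ 1) {p q : TwistedQuotient s} {L : ℝ}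
    (h : dist p q < L) : Close s 1 ((p.height + q.height - L) / 2 - 7) p.torus q.torus := by
  rw [← edist_lt_ofReal, edist_eq] at h
  simp only [iInf_lt_iff] at h
  obtain ⟨p', q', rfl, rfl, hpq⟩ := h
  obtain ⟨h1, h2⟩ := TwistedCover.horizontal_le_of_rdist_lt hs0 hs1 hpq rfl
  refine Close.to_one (k := 13) hs0 hs1 ⟨q'.1 - p'.1, q'.2.1 - p'.2.1, ?_, h1, h2⟩ (by norm_num) ?_
  · rw [AddCircle.coe_sub, AddCircle.coe_sub]; rfl
  · have : (2.7 : ℝ) ≤ Real.exp 1 := by linarith [Real.exp_one_gt_d9]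
    have h3 : Real.exp (1 / 2) * Real.exp (1 / 2) = Real.exp 1 := by
      rw [← Real.exp_add]; norm_num
    have h5 : 1.5 ≤ Real.exp (1 / 2) := by linarith [Real.add_one_le_exp (1 / 2 : ℝ)]
    rw [show (7 : ℝ) / 2 = 1 + 1 + 1 + 1 / 2 by norm_num, Real.exp_add, Real.exp_add, Real.exp_add]
    calc (2 * 13 : ℝ) ≤ 2.7 * 2.7 * 2.7 * 1.5 := by norm_num
      _ ≤ _ := by gcongr

theorem dist_le_of_close {p q : TwistedQuotient s} {k m : ℝ} (h : Close s k m p.torus q.torus)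
    (hp : m ≤ p.height) (hq : m ≤ q.height) :
    dist p q ≤ p.height + q.height - 2 * m + 2 * k := by
  obtain ⟨x, y, hxy, h1, h2⟩ := h
  have h0 : 0 ≤ Real.exp m * |y| := by positivity
  rw [← edist_le_ofReal (by linarith), edist_eq]
  obtain ⟨p', rfl⟩ := proj_surjective p
  refine (iInf₂_le_of_le p' (p'.1 + x, p'.2.1 + y, q.height) (iInf₂_le rfl ?_)).trans ?_
  · refine Prod.ext (Prod.ext ?_ ?_) rfl
    · have := congrArg Prod.fst hxy
      exact (AddCircle.coe_add _ _ _).trans (add_comm _ _ |>.trans (sub_eq_iff_eq_add.1 this).symm)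
    · have := congrArg Prod.snd hxy
      exact (AddCircle.coe_add _ _ _).trans (add_comm _ _ |>.trans (sub_eq_iff_eq_add.1 this).symm)
  · refine (TwistedCover.rdist_le_of_le_height p' _ hp hq).trans (ENNReal.ofReal_le_ofReal ?_)
    simp only [add_sub_cancel_left]
    have e : p'.2.2 = (proj p').height := rfl
    rw [e]
    linarith

theorem dist_le_of_nonpos (hs0 : 0 ≤ s) (hs1 : s ≤ 1) (p q : TwistedQuotient s) {m : ℝ}
    (hm : m ≤ 0) (hp : m ≤ p.height) (hq : m ≤ q.height) :
    dist p q ≤ p.height + q.height - 2 * m + 2 := by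
  simpa using dist_le_of_close (close_of_nonpos hs0 hs1 hm p.torus q.torus) hp hq

@[simp] theorem height_origin : (origin s).height = 0 := rfl

theorem abs_height_le_dist_origin (p : TwistedQuotient s) : |p.height| ≤ dist p (origin s) := by
  have := abs_height_sub_le_dist (origin s) p
  rwa [height_origin, sub_zero, dist_comm] at this

/-- Together with `abs_height_le_dist_origin` this lets the absolute height stand for the distance
to the base point: one may cross the torus at height at most 0, at cost at most 2. -/
theorem dist_origin_le (hs0 : 0 ≤ s) (hs1 : s ≤ 1) (p : TwistedQuotient s) :
    dist p (origin s) ≤ |p.height| + 2 := by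
  have h := dist_le_of_nonpos hs0 hs1 p (origin s) (min_le_right p.height 0)
    (min_le_left _ _) (by simp)
  rw [height_origin] at h
  refine h.trans ?_
  rcases le_total p.height 0 with h0 | h0
  · rw [min_eq_left h0, abs_of_nonpos h0]; linarith
  · rw [min_eq_right h0, abs_of_nonneg h0]; linarith

end TwistedQuotient

/-! ### Logarithmic comparison of the metrics on balls -/

theorem log_two_add_two_mul_le {R : ℝ} (hR : 2 ≤ R) : Real.log (2 + 2 * R) ≤ 3 * Real.log R := by
  rw [← Real.log_rpow (by linarith)]
  refine Real.log_le_log (by linarith) ?_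
  norm_cast
  nlinarith [mul_self_nonneg (R - 2)]

theorem one_le_two_mul_log {R : ℝ} (hR : 2 ≤ R) : 1 ≤ 2 * Real.log R := by
  linarith [Real.log_two_gt_d9, Real.log_le_log two_pos hR]

namespace TwistedQuotient

variable {s s' : ℝ}

/-- The identity of `𝕋² × ℝ`, between two different metrics. -/
def change (s' : ℝ) (p : TwistedQuotient s) : TwistedQuotient s' := mk p.torus p.height

@[simp] theorem height_change (p : TwistedQuotient s) : (change s' p).height = p.height := rfl

@[simp] theorem torus_change (p : TwistedQuotient s) : (change s' p).torus = p.torus := rfl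

@[simp] theorem change_change (p : TwistedQuotient s) : change s (change s' p) = p := rfl

/-- The critical height of the pair never exceeds the height of `p`, hence is at most `R`, so the
transfer costs `O(log R)`. For a critical height at most 0 the crossing takes place in the cusp,
where the twist is irrelevant. Only one of the points needs a height bound. -/
theorem dist_change_le (hs0 : 0 ≤ s) (hs1 : s ≤ 1) (hs0' : 0 ≤ s') (hs1' : s' ≤ 1)
    {p q : TwistedQuotient s} {R : ℝ} (hR : 2 ≤ R) (hp : p.height ≤ R) :
    dist (change s' p) (change s' q) ≤ dist p q + 46 * Real.log R := by
  have h1 := close_of_dist_lt hs0 hs1 (lt_add_one (dist p q))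
  have hpq := abs_le.1 (abs_height_sub_le_dist p q)
  have hl := one_le_two_mul_log hR
  set m := (p.height + q.height - (dist p q + 1)) / 2 - 7 with hm
  have hmp : m ≤ p.height := by linarith
  have hmq : m ≤ q.height := by linarith
  rcases le_total m 0 with h0 | h0
  · have := dist_le_of_nonpos hs0' hs1' (change s' p) (change s' q) h0 hmp hmq
    simp only [height_change] at this
    linarith
  · have h2 := h1.transfer hs0 hs1 hs0' hs1' h0
    have h3 : 0 ≤ Real.log (2 + 2 * m) := Real.log_nonneg (by linarith)
    have h4 : Real.log (2 + 2 * m) ≤ Real.log (2 + 2 * R) :=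
      Real.log_le_log (by linarith) (by linarith)
    have h5 := log_two_add_two_mul_le hR
    have := dist_le_of_close (p := change s' p) (q := change s' q) h2
      (by simp only [height_change]; linarith) (by simp only [height_change]; linarith)
    simp only [height_change] at this
    linarith

theorem distortionGrowth_le (hs0 : 0 ≤ s) (hs1 : s ≤ 1) (hs0' : 0 ≤ s') (hs1' : s' ≤ 1) {R : ℝ}
    (hR : 2 ≤ R) :
    distortionGrowth (origin s) (origin s') R ≤ ENNReal.ofReal (56 * Real.log R) := by
  have hl := one_le_two_mul_log hR
  have hh (p : Metric.closedBall (origin s) R) : (p : TwistedQuotient s).height ≤ R :=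
    (le_abs_self _).trans ((abs_height_le_dist_origin _).trans p.2)
  have hf : IsQuasiIsometricEmbedding 1 (46 * Real.log R)
      fun p : Metric.closedBall (origin s) R ↦ change s' (p : TwistedQuotient s) := by
    refine ⟨one_pos, by linarith, fun x y ↦ ?_, fun x y ↦ ?_⟩
    · have := dist_change_le (s' := s) hs0' hs1' hs0 hs1 (p := change s' (x : TwistedQuotient s))
        (q := change s' (y : TwistedQuotient s)) hR (hh x)
      rw [change_change, change_change] at this
      rw [Subtype.dist_eq]
      linarith
    · have := dist_change_le (s' := s') hs0 hs1 hs0' hs1' (p := (x : TwistedQuotient s))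
        (q := y) hR (hh x)
      rw [Subtype.dist_eq]
      linarith
  refine (iInf₂_le_of_le 1 (46 * Real.log R) (iInf₂_le_of_le _ hf
    (iInf_le_of_le (fun p hp ↦ by simp only [hp]; rfl) le_rfl))).trans ?_
  exact ENNReal.ofReal_le_ofReal (by linarith)

/-- The identity need not map a ball exactly into the ball of the same radius. Moving a point by 2
towards height 0 compensates the error in `dist_origin_le`. -/
theorem exists_mem_closedBall (hs0 : 0 ≤ s) (hs1 : s ≤ 1) (p : TwistedQuotient s) {R : ℝ}
    (hR : 0 ≤ R) (hp : |p.height| ≤ R) : ∃ q ∈ Metric.closedBall (origin s) R, dist p q ≤ 4 := by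
  rcases le_total |p.height| 2 with h | h
  · refine ⟨origin s, Metric.mem_closedBall_self hR, ?_⟩
    linarith [dist_origin_le hs0 hs1 p]
  · rcases le_abs.1 h with h' | h'
    · refine ⟨mk p.torus (p.height - 2), (dist_origin_le hs0 hs1 _).trans ?_, ?_⟩
      · rw [height_mk, abs_of_nonneg (by linarith)]
        linarith [le_abs_self p.height]
      · refine (dist_vertical p.torus p.height (p.height - 2)).trans_le ?_
        norm_num
    · refine ⟨mk p.torus (p.height + 2), (dist_origin_le hs0 hs1 _).trans ?_, ?_⟩
      · rw [height_mk, abs_of_nonpos (by linarith)]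
        linarith [neg_le_abs p.height]
      · refine (dist_vertical p.torus p.height (p.height + 2)).trans_le ?_
        norm_num

theorem exists_isQuasiIsometryPair_closedBall (hs0 : 0 ≤ s) (hs1 : s ≤ 1) (hs0' : 0 ≤ s')
    (hs1' : s' ≤ 1) {R : ℝ} (hR : 2 ≤ R) :
    ∃ (lam c : ℝ) (f : Metric.closedBall (origin s) R → Metric.closedBall (origin s') R)
      (g : Metric.closedBall (origin s') R → Metric.closedBall (origin s) R),
      IsQuasiIsometryPair lam c f g ∧ lam + c ≤ 64 * Real.log R := by
  have hl := one_le_two_mul_log hR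
  have key {s s' : ℝ} (hs0 : 0 ≤ s) (hs1 : s ≤ 1) (hs0' : 0 ≤ s') (hs1' : s' ≤ 1) :
      ∃ f : Metric.closedBall (origin s) R → Metric.closedBall (origin s') R,
        (∀ x, dist (change s' x.1) (f x).1 ≤ 4) ∧
        ∀ x y, dist (f x) (f y) ≤ dist x y + (46 * Real.log R + 8) := by
    have hh (p : Metric.closedBall (origin s) R) : |(p : TwistedQuotient s).height| ≤ R :=
      (abs_height_le_dist_origin _).trans p.2
    choose f hf hf' using fun p : Metric.closedBall (origin s) R ↦
      exists_mem_closedBall hs0' hs1' (change s' (p : TwistedQuotient s)) (by linarith) (hh p)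
    refine ⟨fun p ↦ ⟨f p, hf p⟩, hf', fun x y ↦ ?_⟩
    have h1 := dist_change_le (s' := s') hs0 hs1 hs0' hs1' (p := (x : TwistedQuotient s))
        (q := y) hR ((le_abs_self _).trans (hh x))
    have h2 := hf' x
    have h3 := hf' y
    have h4 := dist_triangle4 (f x) (change s' (x : TwistedQuotient s))
      (change s' (y : TwistedQuotient s)) (f y)
    rw [dist_comm (f x) (change s' (x : TwistedQuotient s))] at h4
    simp only [Subtype.dist_eq]
    linarith
  obtain ⟨f, hf, hf'⟩ := key hs0 hs1 hs0' hs1'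
  obtain ⟨g, hg, hg'⟩ := key hs0' hs1' hs0 hs1
  have inv {s s' : ℝ} (hs0 : 0 ≤ s) (hs1 : s ≤ 1) (hs0' : 0 ≤ s') (hs1' : s' ≤ 1)
      {f : Metric.closedBall (origin s) R → Metric.closedBall (origin s') R}
      {g : Metric.closedBall (origin s') R → Metric.closedBall (origin s) R}
      (hf : ∀ x, dist (change s' x.1) (f x).1 ≤ 4)
      (hg : ∀ x, dist (change s x.1) (g x).1 ≤ 4)
      (x : Metric.closedBall (origin s) R) : dist (g (f x)) x ≤ 46 * Real.log R + 8 := by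
    have hh : (f x : TwistedQuotient s').height ≤ R :=
      (le_abs_self _).trans ((abs_height_le_dist_origin _).trans (f x).2)
    have h1 := dist_change_le (s' := s) hs0' hs1' hs0 hs1 (p := (f x : TwistedQuotient s'))
      (q := change s' (x : TwistedQuotient s)) hR hh
    rw [change_change, dist_comm (f x : TwistedQuotient s')] at h1
    have h2 := hg (f x)
    have h3 := hf x
    have h4 := dist_triangle_left (g (f x) : TwistedQuotient s) x
      (change s (f x : TwistedQuotient s'))
    rw [Subtype.dist_eq]
    linarith
  exact ⟨1, 46 * Real.log R + 8, f, g, ⟨one_pos, by linarith, fun x y ↦ by linarith [hf' x y],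
    fun x y ↦ by linarith [hg' x y], inv hs0 hs1 hs0' hs1' hf hg, inv hs0' hs1' hs0 hs1 hg hf⟩,
    by linarith⟩

end TwistedQuotient

/-! ### A coarse embedding separates ends uniformly -/

theorem exists_last_le {σ : ℕ → ℝ} {H : ℝ} {T : ℕ} (h0 : σ 0 ≤ H) (hT : H < σ T) :
    ∃ t < T, σ t ≤ H ∧ ∀ i, t < i → i ≤ T → H < σ i := by
  induction T with
  | zero => exact absurd hT h0.not_gt
  | succ T ih =>
    rcases le_or_gt (σ T) H with h | h
    · refine ⟨T, T.lt_succ_self, h, fun i hi hi' ↦ ?_⟩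
      rwa [show i = T + 1 by omega]
    · obtain ⟨t, ht, ht', h'⟩ := ih h
      refine ⟨t, ht.trans T.lt_succ_self, ht', fun i hi hi' ↦ ?_⟩
      rcases hi'.eq_or_lt with rfl | hi'
      · exact hT
      · exact h' i hi (Nat.lt_succ_iff.1 hi')

theorem summable_one_add_mul_sq_mul_pow (B : ℝ) {ρ : ℝ} (h0 : 0 ≤ ρ) (h1 : ρ < 1) :
    Summable fun i : ℕ ↦ (1 + B * i) ^ 2 * ρ ^ i := by
  have h (k : ℕ) := summable_pow_mul_geometric_of_norm_lt_one k
    (r := ρ) (by rwa [Real.norm_of_nonneg h0])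
  refine (((h 0).add ((h 1).mul_left (2 * B))).add ((h 2).mul_left (B ^ 2))).congr fun i ↦ ?_
  ring

namespace TwistedQuotient

theorem dist_torus_le {p q : TwistedQuotient 0} {r : ℝ} (h : dist p q ≤ r) :
    dist p.torus q.torus ≤ Real.exp (r + 8) * Real.exp (-p.height) := by
  have h1 := close_of_dist_lt le_rfl zero_le_one (h.trans_lt (lt_add_one r))
  have h2 := (abs_le.1 ((abs_height_sub_le_dist p q).trans h)).1
  rw [close_zero_iff, ← le_div_iff₀' (Real.exp_pos _), one_div, ← Real.exp_neg] at h1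
  rw [← Real.exp_add]
  exact h1.trans (Real.exp_le_exp.2 (by linarith))

/-- A quasi-geodesic of the untwisted space that stays above height `H` moves little
horizontally. -/
theorem exists_dist_torus_le_of_above {A l r c : ℝ} (hA : 0 ≤ A) (hl : 0 < l) (hr : 0 ≤ r) :
    ∃ K : ℝ, 0 ≤ K ∧ ∀ (q : ℕ → TwistedQuotient 0) (n : ℕ) (H : ℝ), (q 0).height ≤ H →
      (∀ i ≤ n, H - r ≤ (q i).height) →
      (∀ i < n, dist (q i).torus (q (i + 1)).torus ≤ A * Real.exp (-(q i).height)) →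
      (∀ i ≤ n, (i : ℝ) ≤ l * dist (q 0) (q i) + c) →
      dist (q 0).torus (q n).torus ≤ K * Real.exp (-H) := by
  set B := A * Real.exp r with hB
  have hB0 : 0 ≤ B := by positivity
  set ρ := Real.exp (-1 / l) with hρ
  have hρ1 : ρ < 1 := by
    rw [hρ, Real.exp_lt_one_iff]
    exact div_neg_of_neg_of_pos (by norm_num) hl
  -- The bootstrap: staying near or above `H`, the path drifts at most linearly, so going down to
  -- about `H - log (1 + B * i)` connects `q 0` to `q i`. As these points are at distance at least
  -- `(i - c) / l`, the height of `q i` must grow linearly up to `2 * log (1 + B * i)`, and the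
  -- horizontal steps are summable.
  set w : ℕ → ℝ := fun i ↦ A * Real.exp (2 * r + 2 + c / l) * ((1 + B * i) ^ 2 * ρ ^ i) with hw
  have hws : Summable w :=
    (summable_one_add_mul_sq_mul_pow B (Real.exp_pos _).le hρ1).mul_left _
  have hw0 (i : ℕ) : 0 ≤ w i := by positivity
  refine ⟨∑' i, w i, tsum_nonneg hw0, fun q n H h0 hq hstep hlen ↦ ?_⟩
  have h1 (i : ℕ) (hi : i ≤ n) : dist (q 0).torus (q i).torus ≤ B * i * Real.exp (-H) := by
    have := dist_le_range_sum_of_dist_le (f := fun i ↦ (q i).torus)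
      (d := fun _ ↦ B * Real.exp (-H)) i fun {k} hk ↦ (hstep k (by omega)).trans ?_
    · refine this.trans (le_of_eq ?_)
      rw [Finset.sum_const, Finset.card_range, nsmul_eq_mul]
      ring
    · rw [hB, mul_assoc, ← Real.exp_add]
      gcongr
      linarith [hq k (by omega)]
  have h2 (i : ℕ) (hi : i ≤ n) : A * Real.exp (-(q i).height) ≤ w i * Real.exp (-H) := by
    have hpos : 0 < 1 + B * i := by positivity
    have hlog : 0 ≤ Real.log (1 + B * i) :=
      Real.log_nonneg (by linarith [mul_nonneg hB0 i.cast_nonneg])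
    have h3 : Close 0 1 (H - r - Real.log (1 + B * i)) (q 0).torus (q i).torus := by
      rw [close_zero_iff, sub_eq_add_neg, sub_eq_add_neg, Real.exp_add, Real.exp_add,
        Real.exp_neg (Real.log _), Real.exp_log hpos]
      calc Real.exp H * Real.exp (-r) * (1 + B * i)⁻¹ * dist (q 0).torus (q i).torus
          ≤ Real.exp H * 1 * (1 + B * i)⁻¹ * (B * i * Real.exp (-H)) := by
            gcongr
            · exact Real.exp_le_one_iff.2 (by linarith)
            · exact h1 i hi
        _ = (Real.exp H * Real.exp (-H)) * (B * i / (1 + B * i)) := by ring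
        _ ≤ 1 := by
          rw [← Real.exp_add, add_neg_cancel, Real.exp_zero, one_mul]
          exact div_le_one_of_le₀ (by linarith) hpos.le
    have h4 := dist_le_of_close h3 (by linarith [hq 0 n.zero_le]) (by linarith [hq i hi])
    have h5 := hlen i hi
    have h6 : (i - c) / l ≤ dist (q 0) (q i) := by
      rw [div_le_iff₀' hl]; linarith
    have h7 : -(q i).height ≤ 2 * r + 2 + c / l + 2 * Real.log (1 + B * i) + i * (-1 / l) - H := by
      have : (i - c) / l = - c / l - i * (-1 / l) := by ring
      have h8 : -c / l = -(c / l) := by ring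
      linarith
    calc A * Real.exp (-(q i).height) ≤
        A * Real.exp (2 * r + 2 + c / l + 2 * Real.log (1 + B * i) + i * (-1 / l) - H) := by gcongr
      _ = w i * Real.exp (-H) := by
        rw [hw, sub_eq_add_neg, Real.exp_add, Real.exp_add, Real.exp_add (2 * r + 2 + c / l),
          two_mul (Real.log _), Real.exp_add (Real.log _), Real.exp_log hpos,
          Real.exp_nat_mul]
        ring
  refine (dist_le_range_sum_of_dist_le (f := fun i ↦ (q i).torus)
    (d := fun i ↦ w i * Real.exp (-H)) n fun {k} hk ↦
      (hstep k hk).trans (h2 k hk.le)).trans ?_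
  rw [← Finset.sum_mul]
  gcongr
  exact hws.sum_le_tsum _ fun i _ ↦ hw0 i

/-- `F` is a coarse embedding of the twisted into the untwisted space, with constants that also
control the heights. -/
structure IsControlled (l c : ℝ) (F : TwistedQuotient 1 → TwistedQuotient 0) : Prop where
  intro ::
  one_le : 1 ≤ l
  nonneg : 0 ≤ c
  dist_le : ∀ p q, dist (F p) (F q) ≤ l * dist p q + c
  le_dist : ∀ p q, dist p q ≤ l * dist (F p) (F q) + c
  height_le : ∀ p, |(F p).height| ≤ l * |p.height| + c
  le_height : ∀ p, |p.height| ≤ l * |(F p).height| + c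

/-- The coarse inverse is the map used. Heights are controlled because they measure the distance to
the base point up to 2, and the base point is displaced by a fixed amount. -/
theorem exists_isControlled (h : QuasiIsometric (TwistedQuotient 0) (TwistedQuotient 1)) :
    ∃ l c F, IsControlled l c F := by
  obtain ⟨l, c, f, g, h⟩ := h
  have hc := h.c_nonneg
  set l' := max l 1 with hl'
  have hll' : l ≤ l' := le_max_left _ _
  have hl0 : 0 ≤ l' := zero_le_one.trans (le_max_right _ _)
  set w := dist (g (origin 1)) (origin 0) with hw
  have hw0 : 0 ≤ w := dist_nonneg
  have d1 (p q : TwistedQuotient 1) : dist (g p) (g q) ≤ l' * dist p q + c :=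
    (h.dist_inv_le p q).trans (by gcongr)
  have d2 (p q : TwistedQuotient 1) : dist p q ≤ l' * dist (g p) (g q) + 3 * c := by
    have h2 := h.dist_right_inv p
    have h3 := h.dist_right_inv q
    have h4 := h.dist_map_le (g p) (g q)
    have h5 : l * dist (g p) (g q) ≤ l' * dist (g p) (g q) := by gcongr
    have h6 := dist_triangle4 p (f (g p)) (f (g q)) q
    rw [dist_comm p (f (g p))] at h6
    linarith
  have hlw : 0 ≤ l' * w := by positivity
  have hlw2 : w ≤ l' * w := le_mul_of_one_le_left hw0 (le_max_right _ _)
  refine ⟨l', 3 * c + 3 * l' + l' * w, g, le_max_right _ _, by positivity, fun p q ↦ ?_,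
    fun p q ↦ ?_, fun p ↦ ?_, fun p ↦ ?_⟩
  · linarith [d1 p q]
  · linarith [d2 p q]
  · have h1 := abs_height_le_dist_origin (g p)
    have h2 := dist_triangle (g p) (g (origin 1)) (origin 0)
    have h3 := d1 p (origin 1)
    have h4 := mul_le_mul_of_nonneg_left (dist_origin_le zero_le_one le_rfl p) hl0
    linarith
  · have h1 := abs_height_le_dist_origin p
    have h2 := d2 p (origin 1)
    have h3 := dist_triangle_right (g p) (g (origin 1)) (origin 0)
    have h4 := dist_origin_le le_rfl zero_le_one (g p)
    have h5 : l' * dist (g p) (g (origin 1)) ≤ l' * (|(g p).height| + 2 + w) := by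
      gcongr; linarith
    linarith

/-- Both points are high up and have torus coordinates at distance at most `d`, or both are in
the cusp. -/
def SameEnd (d : ℝ) (p q : TwistedQuotient 0) : Prop :=
  (0 < p.height ∧ 0 < q.height ∧ dist p.torus q.torus ≤ d) ∨ (p.height < 0 ∧ q.height < 0)

namespace SameEnd

variable {d d' : ℝ} {p q w : TwistedQuotient 0}

theorem symm (h : SameEnd d p q) : SameEnd d q p := by
  rcases h with ⟨h1, h2, h3⟩ | ⟨h1, h2⟩
  · exact .inl ⟨h2, h1, dist_comm p.torus q.torus ▸ h3⟩
  · exact .inr ⟨h2, h1⟩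

theorem mono (h : SameEnd d p q) (hd : d ≤ d') : SameEnd d' p q :=
  h.imp_left fun h ↦ ⟨h.1, h.2.1, h.2.2.trans hd⟩

theorem trans (h : SameEnd d p q) (h' : SameEnd d' q w) : SameEnd (d + d') p w := by
  rcases h with ⟨h1, h2, h3⟩ | ⟨h1, h2⟩ <;> rcases h' with ⟨h1', h2', h3'⟩ | ⟨h1', h2'⟩
  · exact .inl ⟨h1, h2', (dist_triangle _ _ _).trans (add_le_add h3 h3')⟩
  · exact absurd h2 h1'.not_gt
  · exact absurd h2 h1'.not_gt
  · exact .inr ⟨h1, h2'⟩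

theorem refl (h : p.height ≠ 0) : SameEnd 0 p p := by
  rcases h.lt_or_gt with h | h
  · exact .inr ⟨h, h⟩
  · exact .inl ⟨h, h, (dist_self _).le⟩

theorem chain {q : ℕ → TwistedQuotient 0} {a : ℕ → ℝ} (h0 : (q 0).height ≠ 0) (n : ℕ)
    (h : ∀ i < n, SameEnd (a i) (q i) (q (i + 1))) :
    SameEnd (∑ i ∈ Finset.range n, a i) (q 0) (q n) := by
  induction n with
  | zero => simpa using refl h0
  | succ n ih =>
    rw [Finset.sum_range_succ]
    exact (ih fun i hi ↦ h i (hi.trans n.lt_succ_self)).trans (h n n.lt_succ_self)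

/-- A step shorter than the absolute height cannot change its sign; on the upper side its horizontal
part is of order `exp (-height)`. -/
theorem of_dist_le {r : ℝ} (h : dist p q ≤ r) (hr : r < |p.height|) :
    SameEnd (Real.exp (r + 8) * Real.exp (-|p.height|)) p q := by
  have h1 := abs_le.1 ((abs_height_sub_le_dist p q).trans h)
  rcases le_total 0 p.height with h0 | h0
  · rw [abs_of_nonneg h0] at hr ⊢
    refine .inl ⟨?_, by linarith, dist_torus_le h⟩
    linarith [dist_nonneg.trans h]
  · rw [abs_of_nonpos h0] at hr
    exact .inr ⟨by linarith [dist_nonneg.trans h], by linarith⟩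

end SameEnd

/-- A half-turn of the first factor of the torus. -/
def halfTurn : UnitAddCircle × UnitAddCircle := (((1 / 2 : ℝ) : UnitAddCircle), 0)

theorem norm_halfTurn : ‖halfTurn‖ = 1 / 2 := by
  have := AddCircle.norm_half_period_eq (1 : ℝ)
  simp only [halfTurn, Prod.norm_def, norm_zero]
  norm_num at this ⊢

/-- Otherwise the torus points would be close at height `11 - 7 = 4`, hence at distance at most `2 *
exp (-2) < 1 / 2`. -/
theorem le_dist_halfTurn {D t t' : ℝ} (ht : D / 2 + 11 ≤ t) (ht' : D / 2 + 11 ≤ t')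
    (P : UnitAddCircle × UnitAddCircle) :
    D ≤ dist (mk P t : TwistedQuotient 1) (mk (P + halfTurn) t') := by
  by_contra! h
  have h1 := (close_of_dist_lt zero_le_one le_rfl h).mono zero_le_one le_rfl (m' := 4)
    (by simp only [height_mk]; linarith)
  have h2 := h1.dist_le zero_le_one le_rfl (by norm_num)
  rw [torus_mk, torus_mk, dist_comm, dist_eq_norm, add_sub_cancel_left, norm_halfTurn] at h2
  have h3 : Real.exp (-4 / 2) * Real.exp 2 = 1 := by rw [← Real.exp_add]; norm_num
  have h4 : 2.5 ≤ Real.exp 1 := by linarith [Real.exp_one_gt_d9]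
  have h5 : Real.exp 2 = Real.exp 1 * Real.exp 1 := by rw [← Real.exp_add]; norm_num
  nlinarith [Real.exp_pos (-4 / 2)]

namespace IsControlled

variable {l c : ℝ} {F : TwistedQuotient 1 → TwistedQuotient 0}

/-- The boundary map of a coarse embedding is uniformly injective. -/
theorem exists_not_sameEnd (hF : IsControlled l c F) :
    ∃ d > 0, ∃ T₀ : ℕ, ∀ T ≥ T₀, ∀ P,
      ¬ SameEnd d (F (mk P T)) (F (mk (P + halfTurn) T)) := by
  have hl : 0 < l := zero_lt_one.trans_le hF.one_le
  have hc := hF.nonneg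
  set r := l + c with hr
  have hr0 : 0 ≤ r := by positivity
  obtain ⟨K, hK0, hK⟩ := exists_dist_torus_le_of_above (A := Real.exp (r + 8)) (r := r) (c := c)
    (Real.exp_pos _).le hl hr0
  -- Points whose images are within `2 * r + 4 * K + 2` are at distance less than `D`. The level `H`
  -- below is chosen so that an image at absolute height at least `H - r` forces time at least `D /
  -- 2 + 11`, where points a half-turn apart have distance at least `D`.
  set D := l * (2 * r + 4 * K + 2) + c + 1 with hD
  have hD0 : 0 ≤ D := by positivity
  set H := l * (D / 2 + 11) + r + c with hH
  have hHc : c < H := by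
    have : 0 < l * (D / 2 + 11) := by positivity
    linarith
  refine ⟨Real.exp (-H), Real.exp_pos _, ⌈l * H + c⌉₊ + 1, fun T hT P hS ↦ ?_⟩
  have hT' : l * H + c < T := (Nat.le_ceil _).trans_lt (by exact_mod_cast hT)
  have step (P) (i : ℕ) : dist (F (mk P i)) (F (mk P (i + 1 : ℕ))) ≤ r := by
    refine (hF.dist_le _ _).trans ?_
    rw [dist_vertical]
    simp [hr]
  have hstep (P) (i : ℕ) := abs_le.1 ((abs_height_sub_le_dist _ _).trans (step P i))
  have h0 (P) : |(F (mk P (0 : ℕ))).height| ≤ H := by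
    have := hF.height_le (mk P (0 : ℕ))
    simp only [height_mk, Nat.cast_zero, abs_zero, mul_zero, zero_add] at this
    simpa using this.trans hHc.le
  have hend (P) : H < |(F (mk P T)).height| := by
    have := hF.le_height (mk P T)
    rw [height_mk, abs_of_nonneg T.cast_nonneg] at this
    by_contra! h
    have := mul_le_mul_of_nonneg_left h hl.le
    linarith
  have htime (P) (t : ℕ) (h : H - r ≤ |(F (mk P t)).height|) : D / 2 + 11 ≤ t := by
    have := hF.height_le (mk P t)
    rw [height_mk, abs_of_nonneg (a := (t : ℝ)) t.cast_nonneg] at this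
    refine le_of_mul_le_mul_left ?_ hl
    linarith
  have fin (P) (t t' : ℕ) (h : H - r ≤ |(F (mk P t)).height|)
      (h' : H - r ≤ |(F (mk (P + halfTurn) t')).height|)
      (hd : dist (F (mk P t)) (F (mk (P + halfTurn) t')) ≤ 2 * r + 4 * K + 2) : False := by
    have h1 := le_dist_halfTurn (htime P t h) (htime _ t' h') P
    have h2 := hF.le_dist (mk P t) (mk (P + halfTurn) t')
    have h3 := mul_le_mul_of_nonneg_left hd hl.le
    linarith
  rcases hS with ⟨h1, h2, h3⟩ | ⟨h1, h2⟩
  · have up (P) (hP : 0 < (F (mk P T)).height) : ∃ t : ℕ, (F (mk P t)).height ≤ H ∧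
        H - r ≤ (F (mk P t)).height ∧
        dist (F (mk P t)).torus (F (mk P T)).torus ≤ K * Real.exp (-H) := by
      -- After its last passage through level `H` the image of the ray stays above, so it moves
      -- horizontally by at most `K * exp (-H)`. Thus closeness at time `T` is carried back to level
      -- `H`.
      obtain ⟨t, htT, ht, ht'⟩ := exists_last_le (σ := fun i : ℕ ↦ (F (mk P i)).height)
        (le_of_abs_le (h0 P)) (abs_of_pos hP ▸ hend P)
      have hlow : H - r ≤ (F (mk P t)).height := by
        linarith [ht' (t + 1) t.lt_succ_self htT, (hstep P t).2]
      refine ⟨t, ht, hlow, ?_⟩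
      have := hK (fun i ↦ F (mk P (t + i : ℕ))) (T - t) H ht ?_ ?_ ?_
      · simpa [Nat.add_sub_cancel' htT.le] using this
      · intro i hi
        rcases i.eq_zero_or_pos with rfl | hi0
        · exact hlow
        · linarith [ht' (t + i) (by omega) (by omega)]
      · exact fun i hi ↦ dist_torus_le (step P (t + i))
      · intro i hi
        have := hF.le_dist (mk P (t + 0 : ℕ)) (mk P (t + i : ℕ))
        rw [dist_vertical] at this
        simpa using this
    obtain ⟨t, k1, k2, k3⟩ := up P h1
    obtain ⟨t', k1', k2', k3'⟩ := up _ h2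
    refine fin P t t' (k2.trans (le_abs_self _)) (k2'.trans (le_abs_self _)) ?_
    have hcl : Close 0 (2 * K + 1) (H - r) (F (mk P t)).torus
        (F (mk (P + halfTurn) t')).torus := by
      rw [close_zero_iff]
      have h4 := dist_triangle4 (F (mk P t)).torus (F (mk P T)).torus
        (F (mk (P + halfTurn) T)).torus (F (mk (P + halfTurn) t')).torus
      rw [dist_comm (F (mk (P + halfTurn) T)).torus] at h4
      calc Real.exp (H - r) * dist (F (mk P t)).torus (F (mk (P + halfTurn) t')).torus
          ≤ Real.exp H * ((2 * K + 1) * Real.exp (-H)) := by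
            gcongr
            · linarith
            · linarith
        _ = (2 * K + 1) * (Real.exp H * Real.exp (-H)) := by ring
        _ = 2 * K + 1 := by rw [← Real.exp_add]; simp
    linarith [dist_le_of_close hcl k2 k2']
  · have down (P) (hP : (F (mk P T)).height < 0) : ∃ t : ℕ, -H ≤ (F (mk P t)).height ∧
        (F (mk P t)).height ≤ -H + r := by
      obtain ⟨t, htT, ht, ht'⟩ := exists_last_le (σ := fun i : ℕ ↦ -(F (mk P i)).height)
        (neg_le_of_abs_le (h0 P) |> neg_le.1) (abs_of_neg hP ▸ hend P)
      exact ⟨t, neg_le.1 ht, by linarith [ht' (t + 1) t.lt_succ_self htT, (hstep P t).1]⟩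
    obtain ⟨t, k1, k2⟩ := down P h1
    obtain ⟨t', k1', k2'⟩ := down _ h2
    refine fin P t t' (le_abs.2 (.inr (by linarith))) (le_abs.2 (.inr (by linarith))) ?_
    have := dist_le_of_nonpos le_rfl zero_le_one _ _ (by linarith : -H ≤ 0) k1 k1'
    linarith

end IsControlled

end TwistedQuotient

/-! ### Volume count and averages over grids -/

theorem UnitAddCircle.exists_mem_Ico (z : UnitAddCircle) :
    ∃ x : ℝ, 0 ≤ x ∧ x < 1 ∧ (x : UnitAddCircle) = z := by
  obtain ⟨x, rfl⟩ := QuotientAddGroup.mk_surjective z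
  refine ⟨Int.fract x, Int.fract_nonneg x, Int.fract_lt_one x, ?_⟩
  have : ((⌊x⌋ : ℝ) : UnitAddCircle) = 0 := (AddCircle.coe_eq_zero_iff (1 : ℝ)).2 ⟨⌊x⌋, by simp⟩
  rw [Int.fract, AddCircle.coe_sub, this, sub_zero]

/-- The bounds hold from every base point, so averaging over `G × G'` bounds the mean of both
functions at once. This yields one `P` that suits the slanted paths at both heights, although their
grids are different. -/
theorem exists_add_le_of_sum_le {V G G' : Type*} [AddCommGroup V] [Fintype G] [Fintype G']
    [Nonempty G] [Nonempty G'] (a : G → V) (a' : G' → V) (h h' : V → ℝ) {d d' : ℝ}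
    (hd : ∀ z, ∑ g, h (z + a g) ≤ Fintype.card G * d)
    (hd' : ∀ z, ∑ g, h' (z + a' g) ≤ Fintype.card G' * d') : ∃ z, h z + h' z ≤ d + d' := by
  have h1 : ∑ x : G × G', (h (a x.1 + a' x.2) + h' (a x.1 + a' x.2)) ≤
      ∑ _x : G × G', (d + d') := by
    rw [Finset.sum_add_distrib, Finset.sum_add_distrib]
    refine add_le_add ?_ ?_
    · rw [Fintype.sum_prod_type_right, Fintype.sum_prod_type_right]
      refine Finset.sum_le_sum fun g' _ ↦ ?_
      simpa [add_comm] using hd (a' g')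
    · rw [Fintype.sum_prod_type, Fintype.sum_prod_type]
      refine Finset.sum_le_sum fun g _ ↦ ?_
      simpa using hd' (a g)
  obtain ⟨x, -, hx⟩ := Finset.exists_le_of_sum_le Finset.univ_nonempty h1
  exact ⟨_, hx⟩

namespace TwistedQuotient

/-- Points of the untwisted space in the same cell of the grid of cells of size `1`. -/
theorem dist_le_four {p q : TwistedQuotient 0} {k : ℕ} (hp : ⌊|p.height|⌋₊ = k)
    (hq : ⌊|q.height|⌋₊ = k) (hpq : 0 ≤ p.height ↔ 0 ≤ q.height)
    (h : dist p.torus q.torus ≤ Real.exp (-k)) : dist p q ≤ 4 := by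
  obtain ⟨h1, h2⟩ := (Nat.floor_eq_iff (abs_nonneg _)).1 hp
  obtain ⟨h3, h4⟩ := (Nat.floor_eq_iff (abs_nonneg _)).1 hq
  by_cases h0 : 0 ≤ p.height
  · rw [abs_of_nonneg h0] at h1 h2
    rw [abs_of_nonneg (hpq.1 h0)] at h3 h4
    have : Close 0 1 k p.torus q.torus := by
      rwa [close_zero_iff, ← le_div_iff₀' (Real.exp_pos _), one_div, ← Real.exp_neg]
    linarith [dist_le_of_close this h1 h3]
  · have h0' : ¬ 0 ≤ q.height := fun h ↦ h0 (hpq.2 h)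
    rw [abs_of_neg (not_le.1 h0)] at h1 h2
    rw [abs_of_neg (not_le.1 h0')] at h3 h4
    have hk : (0 : ℝ) ≤ k := k.cast_nonneg
    linarith [dist_le_of_nonpos le_rfl zero_le_one p q (by linarith : -((k : ℝ) + 1) ≤ 0)
      (by linarith) (by linarith)]

theorem abs_sub_le_one_of_floor_eq {x y : ℝ} (hx : 0 ≤ x) (hy : 0 ≤ y) (h : ⌊x⌋₊ = ⌊y⌋₊) :
    |x - y| ≤ 1 := by
  obtain ⟨h1, h2⟩ := (Nat.floor_eq_iff hx).1 h
  have h3 := Nat.floor_le hy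
  have h4 := Nat.lt_floor_add_one y
  exact abs_le.2 ⟨by linarith, by linarith⟩

/-- The volume estimate in the untwisted space. -/
theorem sum_exp_neg_height_le {ι : Type*} [Fintype ι] (p : ι → TwistedQuotient 0) {K : ℝ}
    (hK : ∀ i, |(p i).height| ≤ K) (hK0 : 0 ≤ K) (hp : ∀ i j, dist (p i) (p j) ≤ 4 → i = j) :
    ∑ i, Real.exp (-|(p i).height|) ^ 2 ≤ 8 * (K + 1) := by
  classical
  choose x hx0 hx1 hx using fun i ↦ UnitAddCircle.exists_mem_Ico (p i).torus.1
  choose y hy0 hy1 hy using fun i ↦ UnitAddCircle.exists_mem_Ico (p i).torus.2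
  set κ : ι → ℕ := fun i ↦ ⌊|(p i).height|⌋₊ with hκ
  have hmaps : ∀ i ∈ Finset.univ, κ i ∈ Finset.range (⌊K⌋₊ + 1) := fun i _ ↦
    Finset.mem_range.2 (Nat.lt_succ_of_le (Nat.floor_le_floor (hK i)))
  rw [← Finset.sum_fiberwise_of_maps_to hmaps]
  -- In the unit layer at absolute height `k` there are at most two signs times `(2 * exp k) ^ 2`
  -- cells, each holding at most one of the separated points, with weight at most `exp (-k) ^ 2`. So
  -- every layer contributes `O(1)`, and the total is linear in `K`.
  have hfib (k : ℕ) : ∑ i with κ i = k, Real.exp (-|(p i).height|) ^ 2 ≤ 8 := by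
    set e := Real.exp k with he
    have he0 : 0 < e := Real.exp_pos _
    have he1 : 1 ≤ e := Real.one_le_exp k.cast_nonneg
    set n := ⌊e⌋₊ + 1 with hn
    have hn2 : (n : ℝ) ≤ 2 * e := by
      rw [hn]; push_cast; linarith [Nat.floor_le he0.le]
    have hcard : (Finset.univ.filter fun i ↦ κ i = k).card ≤
        ((Finset.univ : Finset Bool) ×ˢ (Finset.range n ×ˢ Finset.range n)).card := by
      refine Finset.card_le_card_of_injOn
        (fun i ↦ (decide (0 ≤ (p i).height), ⌊e * x i⌋₊, ⌊e * y i⌋₊)) ?_ ?_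
      · intro i _
        have b (z : ℝ) (hz : z < 1) : ⌊e * z⌋₊ < n :=
          Nat.lt_succ_of_le (Nat.floor_le_floor (mul_le_of_le_one_right he0.le hz.le))
        simpa using ⟨le_or_gt _ _, b _ (hx1 i), b _ (hy1 i)⟩
      · intro i hi j hj hij
        simp only [Finset.coe_filter, Finset.mem_univ, true_and, mem_ofPred_eq] at hi hj
        simp only [Prod.mk.injEq, decide_eq_decide] at hij
        refine hp i j (dist_le_four hi hj hij.1 ?_)
        have b (z : ι → ℝ) (hz0 : ∀ i, 0 ≤ z i) (h : ⌊e * z i⌋₊ = ⌊e * z j⌋₊) :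
            |z j - z i| ≤ Real.exp (-k) := by
          have := abs_sub_le_one_of_floor_eq (mul_nonneg he0.le (hz0 i))
            (mul_nonneg he0.le (hz0 j)) h
          rw [abs_sub_comm, ← mul_sub, abs_mul, abs_of_pos he0] at this
          rw [Real.exp_neg, ← one_div]
          exact (le_div_iff₀' he0).2 this
        refine dist_le_of_coe (x := x j - x i) (y := y j - y i) ?_ (b x hx0 hij.2.1)
          (b y hy0 hij.2.2)
        rw [AddCircle.coe_sub, AddCircle.coe_sub, hx, hx, hy, hy]
        rfl
    have hterm (i : ι) (hi : i ∈ Finset.univ.filter fun i ↦ κ i = k) :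
        Real.exp (-|(p i).height|) ^ 2 ≤ (e⁻¹) ^ 2 := by
      rw [he, ← Real.exp_neg]
      have := ((Nat.floor_eq_iff (abs_nonneg _)).1 (Finset.mem_filter.1 hi).2).1
      gcongr
    calc _ ≤ (Finset.univ.filter fun i ↦ κ i = k).card • (e⁻¹) ^ 2 :=
          Finset.sum_le_card_nsmul _ _ _ hterm
      _ ≤ (2 * ((n : ℝ) * n)) * (e⁻¹) ^ 2 := by
        rw [nsmul_eq_mul]
        gcongr
        have h2 : ((Finset.univ.filter fun i ↦ κ i = k).card : ℝ) ≤
            ((2 * (n * n) : ℕ) : ℝ) := by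
          refine Nat.cast_le.2 (hcard.trans (le_of_eq ?_))
          simp [Finset.card_product]
        simpa using h2
      _ ≤ (2 * ((2 * e) * (2 * e))) * (e⁻¹) ^ 2 := by gcongr
      _ = 8 := by field_simp; norm_num
  calc _ ≤ ∑ k ∈ Finset.range (⌊K⌋₊ + 1), (8 : ℝ) := Finset.sum_le_sum fun k _ ↦ hfib k
    _ = 8 * (⌊K⌋₊ + 1) := by simp; ring
    _ ≤ 8 * (K + 1) := by gcongr; exact Nat.floor_le hK0

/-- The subgroup of points of order `N` of the torus. -/
def grid (N : ℕ) [NeZero N] : ZMod N × ZMod N →+ UnitAddCircle × UnitAddCircle :=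
  AddMonoidHom.prodMap ZMod.toAddCircle ZMod.toAddCircle

theorem grid_intCast {N : ℕ} [NeZero N] (i j : ℤ) :
    grid N ((i : ZMod N), (j : ZMod N)) =
      (((i / N : ℝ) : UnitAddCircle), ((j / N : ℝ) : UnitAddCircle)) :=
  Prod.ext (ZMod.toAddCircle_intCast i) (ZMod.toAddCircle_intCast j)

theorem eq_zero_of_toAddCircle_eq {N : ℕ} [NeZero N] {j : ZMod N} {x : ℝ}
    (h : ZMod.toAddCircle j = (x : UnitAddCircle)) (hx : N * |x| < 1) : j = 0 := by
  obtain ⟨j, rfl⟩ := ZMod.intCast_surjective j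
  rw [ZMod.toAddCircle_intCast] at h
  have h1 : (((j / N : ℝ) - x : ℝ) : UnitAddCircle) = 0 := by
    rw [AddCircle.coe_sub]; exact sub_eq_zero.2 h
  obtain ⟨k, hk⟩ := (AddCircle.coe_eq_zero_iff (1 : ℝ)).1 h1
  have hN : (0 : ℝ) < N := Nat.cast_pos.2 (NeZero.pos N)
  have h2 : (j : ℝ) - k * N = N * x := by
    have : (j : ℝ) / N = k + x := by
      have : (k : ℝ) = j / N - x := by simpa using hk
      linarith
    rw [div_eq_iff hN.ne'] at this
    linarith
  have h3 : |((j - k * N : ℤ) : ℝ)| < 1 := by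
    push_cast
    rw [h2, abs_mul, abs_of_pos hN]
    exact hx
  have h4 : j - k * N = 0 := Int.abs_lt_one_iff.1 (by exact_mod_cast h3)
  rw [sub_eq_zero.1 h4]
  simp

/-- Distinct grid points of spacing `1 / N` are separated by at least `D` once `exp t` is large
compared with `N`. The second coordinate must be treated first. -/
theorem eq_zero_of_dist_grid_lt {N : ℕ} [NeZero N] {D t : ℝ}
    (hN : N * Real.exp (D / 2 + 7) < Real.exp t) (P : UnitAddCircle × UnitAddCircle)
    (g : ZMod N × ZMod N)
    (h : dist (mk P t : TwistedQuotient 1) (mk (P + grid N g) t) < D) : g = 0 := by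
  obtain ⟨x, y, hxy, h1, h2⟩ := close_of_dist_lt zero_le_one le_rfl h
  simp only [height_mk, torus_mk, add_sub_cancel_left] at hxy h1 h2
  set m := (t + t - D) / 2 - 7 with hm
  have hem : (N : ℝ) < Real.exp m := by
    have : Real.exp t = Real.exp m * Real.exp (D / 2 + 7) := by
      rw [← Real.exp_add, hm]; ring_nf
    rw [this] at hN
    exact lt_of_mul_lt_mul_right hN (Real.exp_pos _).le
  have key (x : ℝ) (hx : Real.exp m * |x| ≤ 1) : N * |x| < 1 := by
    rcases (abs_nonneg x).eq_or_lt with h | h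
    · simp [← h]
    · exact (mul_lt_mul_of_pos_right hem h).trans_le hx
  have hy := key y h2
  have hg2 : g.2 = 0 := eq_zero_of_toAddCircle_eq (congrArg Prod.snd hxy) hy
  -- The real lift `y`, not just its class, has to vanish in order to remove the shear term from the
  -- bound on `x`.
  have hy0 : y = 0 := by
    have h3 : (y : UnitAddCircle) = 0 := by
      rw [← show (grid N g).2 = y from congrArg Prod.snd hxy]
      exact (congrArg ZMod.toAddCircle hg2).trans (map_zero _)
    obtain ⟨k, hk⟩ := (AddCircle.coe_eq_zero_iff (1 : ℝ)).1 h3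
    rw [zsmul_eq_mul, mul_one] at hk
    have hN1 : (1 : ℝ) ≤ N := by exact_mod_cast NeZero.one_le
    have h4 : |(k : ℝ)| < 1 := by
      rw [hk]
      exact (le_mul_of_one_le_left (abs_nonneg y) hN1).trans_lt hy
    rw [← hk, Int.abs_lt_one_iff.1 (by exact_mod_cast h4 : |k| < 1), Int.cast_zero]
  rw [hy0, mul_zero, add_zero] at h1
  exact Prod.ext (eq_zero_of_toAddCircle_eq (congrArg Prod.fst hxy) (key x h1)) hg2

theorem nsmul_grid {N : ℕ} [NeZero N] (T n : ℕ) :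
    n • grid N (((-T : ℤ) : ZMod N), ((1 : ℤ) : ZMod N)) =
      (((-T * (n / N) : ℝ) : UnitAddCircle), ((n / N : ℝ) : UnitAddCircle)) := by
  rw [grid_intCast]
  refine Prod.ext ?_ ?_
  · change n • (((-T : ℤ) / N : ℝ) : UnitAddCircle) = _
    rw [← AddCircle.coe_nsmul, nsmul_eq_mul]
    push_cast
    ring_nf
  · change n • (((1 : ℤ) / N : ℝ) : UnitAddCircle) = _
    rw [← AddCircle.coe_nsmul, nsmul_eq_mul]
    push_cast
    ring_nf

/-- At height `T`, moving in the direction `(-T, 1)` is cheap. -/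
theorem dist_slant_le {N : ℕ} [NeZero N] {T : ℕ} {M : ℝ} (hN : Real.exp T ≤ M * N)
    (P : UnitAddCircle × UnitAddCircle) :
    dist (mk P T : TwistedQuotient 1)
      (mk (P + grid N (((-T : ℤ) : ZMod N), ((1 : ℤ) : ZMod N))) T) ≤ 2 * M := by
  have hN0 : (0 : ℝ) < N := Nat.cast_pos.2 (NeZero.pos N)
  have h : Close 1 M T P (P + grid N (((-T : ℤ) : ZMod N), ((1 : ℤ) : ZMod N))) := by
    refine ⟨((-T : ℤ) / N : ℝ), ((1 : ℤ) / N : ℝ), ?_, ?_, ?_⟩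
    · rw [add_sub_cancel_left, grid_intCast]
    · push_cast
      have : (-(T : ℝ) / N + 1 * T * (1 / N)) = 0 := by ring
      rw [this, abs_zero, mul_zero]
      exact nonneg_of_mul_nonneg_left ((Real.exp_pos _).le.trans hN) hN0
    · push_cast
      rwa [abs_of_pos (by positivity), mul_one_div, div_le_iff₀ hN0]
  have := dist_le_of_close (p := (mk P T : TwistedQuotient 1)) (q := mk _ T) h le_rfl le_rfl
  simp only [height_mk] at this
  linarith

namespace IsControlled

variable {l c : ℝ} {F : TwistedQuotient 1 → TwistedQuotient 0}

theorem sum_exp_grid_le (hF : IsControlled l c F) {N : ℕ} [NeZero N] {T : ℕ}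
    (hN : N * Real.exp ((4 * l + c + 1) / 2 + 7) < Real.exp T)
    (z : UnitAddCircle × UnitAddCircle) :
    ∑ g, Real.exp (-|(F (mk (z + grid N g) T)).height|) ≤
      N * √(8 * (l * T + c + 1)) := by
  have hl : 0 < l := zero_lt_one.trans_le hF.one_le
  have hc := hF.nonneg
  have h1 := sum_exp_neg_height_le (fun g ↦ F (mk (z + grid N g) T)) (K := l * T + c)
    (fun g ↦ by simpa using hF.height_le (mk (z + grid N g) T)) (by positivity) (by
      intro g g' h
      have h2 := hF.le_dist (mk (z + grid N g) T) (mk (z + grid N g') T)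
      have h3 := eq_zero_of_dist_grid_lt hN (z + grid N g) (g' - g) (by
        rw [add_assoc, ← map_add, add_sub_cancel]
        linarith [mul_le_mul_of_nonneg_left h hl.le])
      exact (sub_eq_zero.1 h3).symm)
  -- Cauchy–Schwarz over the `N ^ 2` grid points: the volume count bounds the sum of squares by a
  -- linear function of `T`, so the mean of `exp (-|height|)` is `O(√T / N)`.
  have h2 := sq_sum_le_card_mul_sum_sq (s := Finset.univ)
    (f := fun g ↦ Real.exp (-|(F (mk (z + grid N g) T)).height|))
  have h3 : ((Finset.univ : Finset (ZMod N × ZMod N)).card : ℝ) = N ^ 2 := by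
    rw [Finset.card_univ, Fintype.card_prod, ZMod.card]; push_cast; ring
  refine le_of_sq_le_sq ?_ (by positivity)
  rw [mul_pow, Real.sq_sqrt (by positivity)]
  rw [h3] at h2
  exact h2.trans (by gcongr)

theorem sum_sum_exp_grid_le (hF : IsControlled l c F) {N : ℕ} [NeZero N] {T : ℕ}
    (hN : N * Real.exp ((4 * l + c + 1) / 2 + 7) < Real.exp T)
    (z : UnitAddCircle × UnitAddCircle) (n : ℕ) (e : ZMod N × ZMod N) :
    ∑ g, ∑ i ∈ Finset.range n,
      Real.exp (-|(F (mk (z + grid N g + i • grid N e) T)).height|) ≤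
      Fintype.card (ZMod N × ZMod N) * (n / N * √(8 * (l * T + c + 1))) := by
  have hN0 : (0 : ℝ) < N := Nat.cast_pos.2 (NeZero.pos N)
  rw [Finset.sum_comm]
  have h (i : ℕ) : ∑ g, Real.exp (-|(F (mk (z + grid N g + i • grid N e) T)).height|) ≤
      N * √(8 * (l * T + c + 1)) := by
    refine le_of_eq_of_le ?_ (hF.sum_exp_grid_le hN z)
    -- Translation by a grid vector permutes the grid, so each of the `n` steps has the same
    -- average.
    refine Fintype.sum_equiv (Equiv.addRight (i • e)) _ _ fun g ↦ ?_
    rw [Equiv.coe_addRight, map_add, map_nsmul, add_assoc]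
  calc _ ≤ ∑ i ∈ Finset.range n, N * √(8 * (l * T + c + 1)) := Finset.sum_le_sum fun i _ ↦ h i
    _ = _ := by
      rw [Finset.sum_const, Finset.card_range, nsmul_eq_mul, Fintype.card_prod, ZMod.card]
      push_cast
      field_simp

end IsControlled

end TwistedQuotient

/-! ### A path joining points a half-turn apart with small image displacement -/

/-- With `E = exp T`, the grid must be coarse enough for its points to be separated (`N * M < E`)
and fine enough for a slanted step to have bounded length (`E ≤ 4 * M * N`). Divisibility by `2 * m`
makes `n` steps of size `1 / N` add up to exactly `1 / (2 * m)`. -/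
theorem exists_nat_grid {M E : ℝ} {m : ℕ} (hM : 0 < M) (hm : 0 < m) (h : 4 * m * M ≤ E) :
    ∃ n N : ℕ, 0 < N ∧ N = 2 * m * n ∧ N * M < E ∧ E ≤ 4 * M * N := by
  have hm' : (0 : ℝ) < m := Nat.cast_pos.2 hm
  set x := E / (4 * m * M) with hx
  have hE : E = 4 * m * M * x := by rw [hx]; field_simp
  have hx1 : 1 ≤ x := (one_le_div (by positivity)).2 h
  have h1 : 1 ≤ ⌊x⌋₊ := Nat.le_floor (by simpa using hx1)
  have h2 := Nat.floor_le (zero_le_one.trans hx1)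
  have h3 := Nat.lt_floor_add_one x
  have h1' : (1 : ℝ) ≤ ⌊x⌋₊ := by exact_mod_cast h1
  have hmM : 0 < m * M := by positivity
  refine ⟨⌊x⌋₊, 2 * m * ⌊x⌋₊, by positivity, rfl, ?_, ?_⟩ <;> push_cast <;> rw [hE]
  · have : m * M * ⌊x⌋₊ ≤ m * M * x := by gcongr
    have : 0 < m * M * x := by positivity
    linarith
  · have : m * M * x ≤ m * M * (⌊x⌋₊ + ⌊x⌋₊) := by gcongr; linarith
    linarith

theorem tendsto_sqrt_div_nat (a b : ℝ) :
    Tendsto (fun m : ℕ ↦ 1 / (2 * m : ℝ) * √(a * m + b)) atTop (𝓝 0) := by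
  have h1 := tendsto_const_div_atTop_nhds_zero_nat (a / 4)
  have h2 := (tendsto_const_div_atTop_nhds_zero_nat (b / 4)).mul
    (tendsto_const_div_atTop_nhds_zero_nat 1)
  have h3 := ((h1.add h2).sqrt)
  simp only [mul_zero, add_zero, Real.sqrt_zero] at h3
  refine h3.congr' ?_
  filter_upwards [eventually_gt_atTop 0] with m hm
  have hm' : (0 : ℝ) < m := Nat.cast_pos.2 hm
  rw [show a / 4 / m + b / 4 / m * (1 / m) = (a * m + b) / (2 * m) ^ 2 by field_simp; ring,
    Real.sqrt_div' _ (by positivity), Real.sqrt_sq (by positivity)]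
  ring

theorem tendsto_nat_mul_exp_neg {l : ℝ} (hl : 0 < l) (A c : ℝ) :
    Tendsto (fun m : ℕ ↦ m * (A * Real.exp (-((m - c) / l)))) atTop (𝓝 0) := by
  have hρ1 : Real.exp (-1 / l) < 1 := by
    rw [Real.exp_lt_one_iff]
    exact div_neg_of_neg_of_pos (by norm_num) hl
  have h := (tendsto_self_mul_const_pow_of_lt_one (Real.exp_pos _).le hρ1).mul_const
    (A * Real.exp (c / l))
  rw [zero_mul] at h
  refine h.congr fun m ↦ ?_
  rw [← Real.exp_nat_mul, show -((m - c) / l) = m * (-1 / l) + c / l by ring, Real.exp_add]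
  ring

namespace TwistedQuotient

namespace IsControlled

variable {l c : ℝ} {F : TwistedQuotient 1 → TwistedQuotient 0}

theorem div_le_abs_height (hF : IsControlled l c F) (P : UnitAddCircle × UnitAddCircle)
    {m T : ℕ} (hT : m ≤ T) : (m - c) / l ≤ |(F (mk P T)).height| := by
  have := hF.le_height (mk P T)
  rw [height_mk, abs_of_nonneg (a := (T : ℝ)) T.cast_nonneg] at this
  rw [div_le_iff₀' (zero_lt_one.trans_le hF.one_le)]
  have : (m : ℝ) ≤ T := Nat.cast_le.2 hT
  linarith

/-- Every image point on the way has absolute height at least `(m - c) / l`, so all `m` steps are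
exponentially small and none can switch between the cusp and the upper end. -/
theorem sameEnd_vertical (hF : IsControlled l c F) {r : ℝ} (hr : l + c ≤ r) {m : ℕ}
    (hm : r < (m - c) / l) (P : UnitAddCircle × UnitAddCircle) :
    SameEnd (m * (Real.exp (r + 8) * Real.exp (-((m - c) / l))))
      (F (mk P m)) (F (mk P (2 * m : ℕ))) := by
  have hr0 : 0 ≤ r := (add_nonneg (zero_le_one.trans hF.one_le) hF.nonneg).trans hr
  have h := SameEnd.chain (q := fun i ↦ F (mk P (m + i : ℕ)))
    (a := fun _ ↦ Real.exp (r + 8) * Real.exp (-((m - c) / l)))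
    (abs_pos.1 (hr0.trans_lt (hm.trans_le (hF.div_le_abs_height P (m.le_add_right 0))))) m
    fun i _ ↦ by
      have hh := hF.div_le_abs_height P (m.le_add_right i)
      refine (SameEnd.of_dist_le (r := r) ?_ (hm.trans_le hh)).mono (by gcongr)
      refine (hF.dist_le _ _).trans ?_
      rw [dist_vertical]
      push_cast
      rw [show (m : ℝ) + (i + 1) - (m + i) = 1 by ring, abs_one, mul_one]
      exact hr
  rw [Finset.sum_const, Finset.card_range, nsmul_eq_mul] at h
  rwa [two_mul m]

theorem sameEnd_slant (hF : IsControlled l c F) {r M : ℝ} (hr : l * (2 * M) + c ≤ r) {m T : ℕ}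
    (hT : m ≤ T) (hr0 : 0 ≤ r) (hm : r < (m - c) / l) {N : ℕ} [NeZero N]
    (hN : Real.exp T ≤ M * N) (n : ℕ) (P : UnitAddCircle × UnitAddCircle) :
    SameEnd (Real.exp (r + 8) * ∑ i ∈ Finset.range n, Real.exp (-|(F (mk (P +
        i • grid N (((-T : ℤ) : ZMod N), ((1 : ℤ) : ZMod N))) T)).height|))
      (F (mk P T)) (F (mk (P + n • grid N (((-T : ℤ) : ZMod N), ((1 : ℤ) : ZMod N))) T)) := by
  set v := grid N (((-T : ℤ) : ZMod N), ((1 : ℤ) : ZMod N)) with hv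
  have h := SameEnd.chain (q := fun i ↦ F (mk (P + i • v) T))
    (a := fun i ↦ Real.exp (r + 8) * Real.exp (-|(F (mk (P + i • v) T)).height|))
    (abs_pos.1 (hr0.trans_lt (hm.trans_le (hF.div_le_abs_height _ hT)))) n
    fun i _ ↦ by
      refine SameEnd.of_dist_le (r := r) ?_ (hm.trans_le (hF.div_le_abs_height _ hT))
      refine (hF.dist_le _ _).trans (le_trans ?_ hr)
      rw [succ_nsmul, ← add_assoc]
      have := zero_le_one.trans hF.one_le
      gcongr
      exact dist_slant_le hN _
  rw [← Finset.mul_sum] at h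
  simpa using h

theorem exists_sameEnd (hF : IsControlled l c F) {d : ℝ} (hd : 0 < d) (T₀ : ℕ) :
    ∃ T ≥ T₀, ∃ P, SameEnd d (F (mk P T)) (F (mk (P + halfTurn) T)) := by
  have hl : 0 < l := zero_lt_one.trans_le hF.one_le
  have hc := hF.nonneg
  set M := Real.exp ((4 * l + c + 1) / 2 + 7) with hM
  have hM0 : 0 < M := Real.exp_pos _
  have hM1 : 1 ≤ M := Real.one_le_exp (by positivity)
  set r := l * (2 * (4 * M)) + c with hr
  have hr0 : 0 ≤ r := by positivity
  have hlr : l + c ≤ r := by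
    have : l * 1 ≤ l * (2 * (4 * M)) := by gcongr; linarith
    linarith
  set A := Real.exp (r + 8) with hA
  have hA0 : 0 < A := Real.exp_pos _
  have lim1 := tendsto_nat_mul_exp_neg hl A c
  have lim2 := tendsto_sqrt_div_nat (8 * l) (8 * (c + 1))
  have lim3 := tendsto_sqrt_div_nat (16 * l) (8 * (c + 1))
  -- Total displacement of the image path: two vertical segments between heights `m` and `2 * m`,
  -- and one slanted segment at each of these heights.
  have lim := (lim1.const_mul 2).add ((lim2.add lim3).const_mul A)
  simp only [mul_zero, add_zero] at lim
  have lim4 : Tendsto (fun m : ℕ ↦ (m : ℝ) * Real.exp (-(m : ℝ))) atTop (𝓝 0) := by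
    simpa using tendsto_nat_mul_exp_neg one_pos 1 0
  have ev4 : ∀ᶠ m : ℕ in atTop, (m : ℝ) * Real.exp (-(m : ℝ)) < 1 / (4 * M) :=
    lim4.eventually_lt_const (by positivity)
  have ev5 : ∀ᶠ m : ℕ in atTop, l * r + c < m :=
    tendsto_natCast_atTop_atTop.eventually_gt_atTop _
  obtain ⟨m, hmd, hm4, hm5, hm0, hmT⟩ := (lim.eventually_lt_const hd |>.and (ev4.and (ev5.and
    ((eventually_gt_atTop 0).and (eventually_ge_atTop T₀))))).exists
  have hm0' : (0 : ℝ) < m := Nat.cast_pos.2 hm0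
  have hmr : r < (m - c) / l := by
    rw [lt_div_iff₀' hl]; linarith
  have hE : 4 * m * M ≤ Real.exp m := by
    rw [Real.exp_neg, ← div_eq_mul_inv, div_lt_div_iff₀ (Real.exp_pos _) (by positivity)] at hm4
    linarith
  have hE2 : 4 * m * M ≤ Real.exp (2 * m : ℕ) := hE.trans
    (Real.exp_le_exp.2 (by push_cast; linarith))
  obtain ⟨n, N, hN0, hN, hN1, hN2⟩ := exists_nat_grid hM0 hm0 hE
  obtain ⟨n', N', hN0', hN', hN1', hN2'⟩ := exists_nat_grid hM0 hm0 hE2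
  have : NeZero N := ⟨hN0.ne'⟩
  have : NeZero N' := ⟨hN0'.ne'⟩
  have quot {n N : ℕ} (h0 : 0 < N) (h : N = 2 * m * n) : (n / N : ℝ) = 1 / (2 * m) := by
    have hn : n ≠ 0 := by rintro rfl; omega
    have hn' : (n : ℝ) ≠ 0 := Nat.cast_ne_zero.2 hn
    rw [h]; push_cast; field_simp
  set v := (((-m : ℤ) : ZMod N), ((1 : ℤ) : ZMod N)) with hv
  set v' := (((-(2 * m : ℕ) : ℤ) : ZMod N'), ((1 : ℤ) : ZMod N')) with hv'
  obtain ⟨P, hP⟩ := exists_add_le_of_sum_le (grid N) (grid N')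
    (fun z ↦ ∑ i ∈ Finset.range n, Real.exp (-|(F (mk (z + i • grid N v) m)).height|))
    (fun z ↦ ∑ i ∈ Finset.range n', Real.exp (-|(F (mk (z + halfTurn + i • grid N' v')
      (2 * m : ℕ))).height|))
    (fun z ↦ hF.sum_sum_exp_grid_le hN1 z n v)
    (fun z ↦ by
      simpa only [add_right_comm z] using hF.sum_sum_exp_grid_le hN1' (z + halfTurn) n' v')
  refine ⟨2 * m, by omega, P, ?_⟩
  have s1 := hF.sameEnd_vertical hlr hmr P
  have s2 := hF.sameEnd_slant hr.ge le_rfl hr0 hmr hN2 n P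
  have s3 := hF.sameEnd_vertical hlr hmr (P + n • grid N v)
  have s4 := hF.sameEnd_slant hr.ge (by omega : m ≤ 2 * m) hr0 hmr hN2' n' (P + halfTurn)
  -- The slants displace by `(-1 / 2, 1 / (2 * m))` at height `m` and by `(-1, 1 / (2 * m))` at
  -- height `2 * m`; the difference is the half-turn.
  have e : P + halfTurn + n' • grid N' v' = P + n • grid N v := by
    rw [hv, hv', nsmul_grid, nsmul_grid, quot hN0 hN, quot hN0' hN', add_assoc, halfTurn]
    refine congrArg (P + ·) (Prod.ext ((AddCircle.coe_add 1 _ _).symm.trans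
      (congrArg _ ?_)) (zero_add _))
    push_cast
    field_simp
    norm_num
  rw [← hv] at s2
  rw [← hv', e] at s4
  refine ((s1.symm.trans (s2.trans s3)).trans s4.symm).mono (le_trans ?_ hmd.le)
  rw [quot hN0 hN, quot hN0' hN'] at hP
  have e1 : 8 * (l * m + c + 1) = 8 * l * m + 8 * (c + 1) := by ring
  have e2 : 8 * (l * (2 * m : ℕ) + c + 1) = 16 * l * m + 8 * (c + 1) := by push_cast; ring
  rw [e1, e2] at hP
  have := mul_le_mul_of_nonneg_left hP hA0.le
  linarith

end IsControlled

/-- The twisted and the untwisted spaces are not quasi-isometric. -/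
theorem not_quasiIsometric : ¬ QuasiIsometric (TwistedQuotient 0) (TwistedQuotient 1) := by
  intro h
  obtain ⟨l, c, F, hF⟩ := exists_isControlled h
  obtain ⟨d, hd, T₀, hT₀⟩ := hF.exists_not_sameEnd
  obtain ⟨T, hT, P, hP⟩ := hF.exists_sameEnd hd T₀
  exact hT₀ T hT P hP

end TwistedQuotient

/-! ### The ideal boundary as a torus plus a point -/

namespace TwistedQuotient

variable {s : ℝ}

theorem dist_ray (γ : GeodesicRay (TwistedQuotient s)) (r r' : ℝ≥0) :
    dist (γ.1 r) (γ.1 r') = |(r : ℝ) - r'| := by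
  rw [γ.2.dist_eq, NNReal.dist_eq]

/-- The height along a geodesic ray. -/
def rayHeight (γ : GeodesicRay (TwistedQuotient s)) (r : ℝ≥0) : ℝ := (γ.1 r).height

theorem abs_rayHeight_sub_le (γ : GeodesicRay (TwistedQuotient s)) {r r' : ℝ≥0} (h : r ≤ r') :
    |rayHeight γ r' - rayHeight γ r| ≤ r' - r := by
  refine (abs_height_sub_le_dist _ _).trans_eq ?_
  rw [dist_ray, abs_sub_comm, abs_of_nonneg (sub_nonneg.2 (NNReal.coe_le_coe.2 h))]

/-- The ray goes up at unit speed, up to a constant. -/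
def IsUp (γ : GeodesicRay (TwistedQuotient s)) : Prop :=
  ∀ r : ℝ≥0, r ≤ rayHeight γ r + |rayHeight γ 0| + 2

/-- The ray goes down at unit speed, up to a constant. -/
def IsDown (γ : GeodesicRay (TwistedQuotient s)) : Prop :=
  ∀ r : ℝ≥0, r + rayHeight γ r ≤ |rayHeight γ 0| + 2

theorem isUp_or_isDown (hs0 : 0 ≤ s) (hs1 : s ≤ 1) (γ : GeodesicRay (TwistedQuotient s)) :
    IsUp γ ∨ IsDown γ := by
  -- Either alternative holds at each time by crossing at the lowest of the heights of `γ 0`, `γ r`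
  -- and 0. Since `r - rayHeight γ r` and `r + rayHeight γ r` are nondecreasing, a failure of one
  -- alternative persists, so the choice cannot depend on the time.
  have key (r : ℝ≥0) : r ≤ rayHeight γ r + |rayHeight γ 0| + 2 ∨
      r + rayHeight γ r ≤ |rayHeight γ 0| + 2 := by
    have h := dist_le_of_nonpos hs0 hs1 (γ.1 0) (γ.1 r)
      (m := min (min (rayHeight γ 0) (rayHeight γ r)) 0) (min_le_right _ _)
      ((min_le_left _ _).trans (min_le_left _ _)) ((min_le_left _ _).trans (min_le_right _ _))
    rw [dist_ray, NNReal.coe_zero, zero_sub, abs_neg, NNReal.abs_eq] at h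
    change (r : ℝ) ≤ rayHeight γ 0 + rayHeight γ r -
      2 * min (min (rayHeight γ 0) (rayHeight γ r)) 0 + 2 at h
    have h1 := le_abs_self (rayHeight γ 0)
    have h2 := neg_le_abs (rayHeight γ 0)
    rcases min_choice (min (rayHeight γ 0) (rayHeight γ r)) 0 with h3 | h3 <;> rw [h3] at h
    · rcases min_choice (rayHeight γ 0) (rayHeight γ r) with h4 | h4 <;> rw [h4] at h
      · left; linarith
      · right; linarith
    · left; linarith
  by_contra! hcon
  simp only [IsUp, IsDown, not_forall, not_le] at hcon
  obtain ⟨⟨r, hr⟩, r', hr'⟩ := hcon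
  rcases le_total r r' with h | h
  · have := abs_le.1 (abs_rayHeight_sub_le γ h)
    rcases key r' with h1 | h1 <;> linarith
  · have := abs_le.1 (abs_rayHeight_sub_le γ h)
    rcases key r with h1 | h1 <;> linarith

theorem isUp_of_pos (hs0 : 0 ≤ s) (hs1 : s ≤ 1) {γ : GeodesicRay (TwistedQuotient s)} {r : ℝ≥0}
    (hr : |rayHeight γ 0| + 2 ≤ r) (h : 0 < rayHeight γ r) : IsUp γ :=
  (isUp_or_isDown hs0 hs1 γ).resolve_right fun hd ↦ by linarith [hd r]

theorem isDown_of_neg (hs0 : 0 ≤ s) (hs1 : s ≤ 1) {γ : GeodesicRay (TwistedQuotient s)} {r : ℝ≥0}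
    (hr : |rayHeight γ 0| + 2 ≤ r) (h : rayHeight γ r < 0) : IsDown γ :=
  (isUp_or_isDown hs0 hs1 γ).resolve_left fun hd ↦ by linarith [hd r]

/-- A geodesic ray going down the cusp. -/
def downRay (s : ℝ) : GeodesicRay (TwistedQuotient s) :=
  ⟨fun t ↦ mk (0, 0) (-t), Isometry.of_dist_eq fun a b ↦ by
    rw [dist_vertical, NNReal.dist_eq]; ring_nf⟩

theorem endpoint_eq_iff {γ γ' : GeodesicRay (TwistedQuotient s)} :
    γ.endpoint = γ'.endpoint ↔ ∃ C : ℝ, ∀ r, dist (γ.1 r) (γ'.1 r) ≤ C :=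
  Quotient.eq (r := asymptoticSetoid (TwistedQuotient s))

theorem IsDown.endpoint_eq (hs0 : 0 ≤ s) (hs1 : s ≤ 1) {γ : GeodesicRay (TwistedQuotient s)}
    (h : IsDown γ) : γ.endpoint = (downRay s).endpoint := by
  refine endpoint_eq_iff.2 ⟨3 * |rayHeight γ 0| + 4, fun r ↦ ?_⟩
  have h1 := abs_le.1 (abs_rayHeight_sub_le γ (zero_le (a := r)))
  have h2 := abs_nonneg (rayHeight γ 0)
  have h3 := neg_le_abs (rayHeight γ 0)
  have h4 := h r
  simp only [NNReal.coe_zero, sub_zero] at h1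
  have := dist_le_of_nonpos hs0 hs1 (γ.1 r) ((downRay s).1 r) (m := -|rayHeight γ 0| - r)
    (by linarith [r.coe_nonneg]) (by change _ ≤ rayHeight γ r; linarith)
    (by change _ ≤ -(r : ℝ); linarith)
  change _ ≤ rayHeight γ r + -(r : ℝ) - _ + _ at this
  linarith

theorem eq_of_forall_close (hs0 : 0 ≤ s) (hs1 : s ≤ 1) {P Q : UnitAddCircle × UnitAddCircle}
    (h : ∀ m ≥ 0, Close s 1 m P Q) : P = Q := by
  refine dist_le_zero.1 (ge_of_tendsto' (x := atTop)
    (f := fun n : ℕ ↦ 2 * Real.exp (-(n : ℝ) / 2)) ?_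
    fun n ↦ (h n n.cast_nonneg).dist_le hs0 hs1 n.cast_nonneg)
  have h1 : Tendsto (fun n : ℕ ↦ -(n : ℝ) / 2) atTop atBot :=
    (tendsto_neg_atTop_atBot.comp tendsto_natCast_atTop_atTop).atBot_div_const two_pos
  simpa using (Real.tendsto_exp_atBot.comp h1).const_mul 2

theorem verticalRay_endpoint_injective (hs0 : 0 ≤ s) (hs1 : s ≤ 1) :
    Function.Injective fun P ↦ (verticalRay s P).endpoint := by
  intro P Q h
  obtain ⟨C, hC⟩ := endpoint_eq_iff.1 h
  have hC0 : 0 ≤ C := dist_nonneg.trans (hC 0)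
  refine eq_of_forall_close hs0 hs1 fun m hm ↦ ?_
  have h1 := close_of_dist_lt hs0 hs1
    ((hC ⟨m + (C + 1) / 2 + 7, by positivity⟩).trans_lt (lt_add_one C))
  refine h1.mono hs0 hs1 ?_
  change m ≤ (m + (C + 1) / 2 + 7 + (m + (C + 1) / 2 + 7) - (C + 1)) / 2 - 7
  linarith

theorem verticalRay_endpoint_ne_downRay (P : UnitAddCircle × UnitAddCircle) :
    (verticalRay s P).endpoint ≠ (downRay s).endpoint := by
  intro h
  obtain ⟨C, hC⟩ := endpoint_eq_iff.1 h
  have hC0 : 0 ≤ C := dist_nonneg.trans (hC 0)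
  have h1 := (abs_height_sub_le_dist _ _).trans (hC ⟨C + 1, by positivity⟩)
  change |-(C + 1) - (C + 1)| ≤ C at h1
  linarith [(abs_le.1 h1).1]

/-- A ray that goes up is asymptotic to a vertical ray. -/
theorem IsUp.exists_endpoint_eq (hs0 : 0 ≤ s) (hs1 : s ≤ 1) {γ : GeodesicRay (TwistedQuotient s)}
    (h : IsUp γ) : ∃ P, γ.endpoint = (verticalRay s P).endpoint ∧
      ∀ r, Close s 1 (rayHeight γ r - |rayHeight γ 0| - 13) (γ.1 r).torus P := by
  set a := |rayHeight γ 0| with ha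
  have ha0 := le_abs_self (rayHeight γ 0)
  have hb (r : ℝ≥0) : rayHeight γ r ≤ r + a := by
    have h1 := abs_le.1 (abs_rayHeight_sub_le γ (zero_le (a := r)))
    simp only [NNReal.coe_zero, sub_zero] at h1
    linarith
  have h1 {r r' : ℝ≥0} (hr : r ≤ r') :
      Close s 1 (rayHeight γ r - a - 9) (γ.1 r).torus (γ.1 r').torus := by
    refine (close_of_dist_lt hs0 hs1 (lt_add_one _)).mono hs0 hs1 ?_
    rw [dist_ray, abs_sub_comm, abs_of_nonneg (sub_nonneg.2 (NNReal.coe_le_coe.2 hr))]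
    change _ ≤ (rayHeight γ r + rayHeight γ r' - _) / 2 - 7
    linarith [h r', hb r]
  -- Any limit point of the torus coordinates serves: later points are close to earlier ones at
  -- nearly the height of the earlier one.
  obtain ⟨P, φ, hφ, hP⟩ := CompactSpace.tendsto_subseq fun n : ℕ ↦ (γ.1 n).torus
  have h2 (r : ℝ≥0) : Close s 1 (rayHeight γ r - a - 13) (γ.1 r).torus P := by
    set m := max (rayHeight γ r - a - 9) 0 with hm
    have hm0 : 0 ≤ m := le_max_right _ _
    have hpos : 0 < Real.exp m * (1 + m) := by positivity
    have e1 : ∀ᶠ n in atTop, dist (γ.1 (φ n : ℕ)).torus P < (Real.exp m * (1 + m))⁻¹ :=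
      Metric.tendsto_nhds.1 hP _ (by positivity)
    have e2 : ∀ᶠ n in atTop, r ≤ (φ n : ℕ) :=
      (tendsto_natCast_atTop_atTop.comp hφ.tendsto_atTop).eventually_ge_atTop r
    obtain ⟨n, hn1, hn2⟩ := (e1.and e2).exists
    have h3 := close_of_dist_le hs0 hs1 hm0 hn1.le
    rw [mul_inv_cancel₀ hpos.ne'] at h3
    exact ((h1 hn2).trans_one hs0 hs1 (h3.mono hs0 hs1 (le_max_left _ _))).mono hs0 hs1
      (by linarith)
  refine ⟨P, endpoint_eq_iff.2 ⟨3 * a + 30, fun r ↦ ?_⟩, h2⟩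
  have h3 := dist_le_of_close (p := γ.1 r) (q := (verticalRay s P).1 r) (h2 r)
    (by change _ ≤ rayHeight γ r; linarith [abs_nonneg (rayHeight γ 0)])
    (by change _ ≤ (r : ℝ); linarith [hb r])
  change _ ≤ rayHeight γ r + (r : ℝ) - _ + _ at h3
  linarith [h r]

/-- The ideal boundary consists of the endpoints of the vertical rays and of the cusp. -/
def boundaryPoint (s : ℝ) : (UnitAddCircle × UnitAddCircle) ⊕ Unit →
    IdealBoundary (TwistedQuotient s) :=
  Sum.elim (fun P ↦ (verticalRay s P).endpoint) fun _ ↦ (downRay s).endpoint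

theorem boundaryPoint_bijective (hs0 : 0 ≤ s) (hs1 : s ≤ 1) :
    Function.Bijective (boundaryPoint s) := by
  constructor
  · refine (verticalRay_endpoint_injective hs0 hs1).sumElim (fun _ _ _ ↦ rfl) fun P _ ↦
      verticalRay_endpoint_ne_downRay P
  · rintro ⟨γ⟩
    rcases isUp_or_isDown hs0 hs1 γ with h | h
    · obtain ⟨P, hP, -⟩ := h.exists_endpoint_eq hs0 hs1
      exact ⟨.inl P, hP.symm⟩
    · exact ⟨.inr (), (h.endpoint_eq hs0 hs1).symm⟩

theorem continuous_verticalRay (hs0 : 0 ≤ s) (hs1 : s ≤ 1) : Continuous (verticalRay s) := by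
  refine Continuous.subtype_mk (continuous_pi fun r ↦ ?_) _
  refine (LipschitzWith.of_dist_le_mul (K := ⟨2 * (Real.exp r * (1 + r)), by positivity⟩)
    fun P Q ↦ ?_).continuous
  have := dist_le_of_close (p := (mk P r : TwistedQuotient s)) (q := mk Q r)
    (close_of_dist_le hs0 hs1 r.2 le_rfl) le_rfl le_rfl
  simp only [height_mk] at this
  refine this.trans_eq ?_
  change _ = 2 * (Real.exp r * (1 + r)) * dist P Q
  simp only [torus_mk, NNReal.val_eq_coe]
  ring

theorem eventually_dist_ray_lt (γ : GeodesicRay (TwistedQuotient s)) (r : ℝ≥0) :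
    ∀ᶠ γ' : GeodesicRay (TwistedQuotient s) in 𝓝 γ, dist (γ'.1 r) (γ.1 r) < 1 := by
  have h : Continuous fun γ' : GeodesicRay (TwistedQuotient s) ↦ γ'.1 r :=
    (continuous_apply r).comp continuous_subtype_val
  exact h.continuousAt.eventually (Metric.ball_mem_nhds _ one_pos)

theorem eventually_isDown (hs0 : 0 ≤ s) (hs1 : s ≤ 1) {γ : GeodesicRay (TwistedQuotient s)}
    (h : IsDown γ) : ∀ᶠ γ' in 𝓝 γ, IsDown γ' := by
  set r : ℝ≥0 := ⟨|rayHeight γ 0| + 4, by positivity⟩ with hr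
  have hr' : (r : ℝ) = |rayHeight γ 0| + 4 := rfl
  filter_upwards [eventually_dist_ray_lt γ 0, eventually_dist_ray_lt γ r] with γ' h0 h1
  have k0 : |rayHeight γ 0 - rayHeight γ' 0| ≤ 1 := (abs_height_sub_le_dist _ _).trans h0.le
  have k1 : |rayHeight γ r - rayHeight γ' r| ≤ 1 := (abs_height_sub_le_dist _ _).trans h1.le
  have k2 := abs_sub_abs_le_abs_sub (rayHeight γ' 0) (rayHeight γ 0)
  rw [abs_sub_comm] at k2
  exact isDown_of_neg hs0 hs1 (r := r) (by linarith) (by linarith [(abs_le.1 k1).1, h r])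

/-- A single large time suffices: rays close at that time and at time 0 have endpoints close at a
large height, hence close in the torus. This gives continuity of the inverse of the boundary
parametrisation. -/
theorem eventually_isUp (hs0 : 0 ≤ s) (hs1 : s ≤ 1) {γ : GeodesicRay (TwistedQuotient s)}
    {P : UnitAddCircle × UnitAddCircle} (h : IsUp γ)
    (hP : γ.endpoint = (verticalRay s P).endpoint) {ε : ℝ} (hε : 0 < ε) :
    ∀ᶠ γ' in 𝓝 γ, ∃ Q, γ'.endpoint = (verticalRay s Q).endpoint ∧ dist Q P < ε := by
  set a := |rayHeight γ 0| with ha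
  have ha0 : 0 ≤ a := abs_nonneg _
  have lim : Tendsto (fun n : ℕ ↦ 2 * Real.exp (-(n : ℝ) / 2)) atTop (𝓝 0) := by
    have h1 : Tendsto (fun n : ℕ ↦ -(n : ℝ) / 2) atTop atBot :=
      (tendsto_neg_atTop_atBot.comp tendsto_natCast_atTop_atTop).atBot_div_const two_pos
    simpa using (Real.tendsto_exp_atBot.comp h1).const_mul 2
  obtain ⟨n, hn⟩ := (lim.eventually_lt_const hε).exists
  set r : ℝ≥0 := ⟨n + 2 * a + 30, by positivity⟩ with hr
  have hr' : (r : ℝ) = n + 2 * a + 30 := rfl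
  have hn0 : (0 : ℝ) ≤ n := n.cast_nonneg
  obtain ⟨P', hP', hcl⟩ := h.exists_endpoint_eq hs0 hs1
  obtain rfl : P' = P := verticalRay_endpoint_injective hs0 hs1 (hP'.symm.trans hP)
  filter_upwards [eventually_dist_ray_lt γ 0, eventually_dist_ray_lt γ r] with γ' h0 h1
  have k0 : |rayHeight γ 0 - rayHeight γ' 0| ≤ 1 := (abs_height_sub_le_dist _ _).trans h0.le
  have k1 : |rayHeight γ r - rayHeight γ' r| ≤ 1 := (abs_height_sub_le_dist _ _).trans h1.le
  have k2 := abs_sub_abs_le_abs_sub (rayHeight γ' 0) (rayHeight γ 0)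
  rw [abs_sub_comm] at k2
  have k3 := h r
  have k4 := abs_le.1 k1
  have hup : IsUp γ' := isUp_of_pos hs0 hs1 (r := r) (by linarith) (by linarith)
  obtain ⟨Q, hQ, hQcl⟩ := hup.exists_endpoint_eq hs0 hs1
  refine ⟨Q, hQ, lt_of_le_of_lt ?_ hn⟩
  have c1 : Close s 1 (n + 8) (γ'.1 r).torus (γ.1 r).torus := by
    refine (close_of_dist_lt hs0 hs1 h1).mono hs0 hs1 ?_
    change _ ≤ (rayHeight γ' r + rayHeight γ r - 1) / 2 - 7
    linarith
  have c2 : Close s 1 (n + 8) Q (γ'.1 r).torus :=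
    ((hQcl r).mono hs0 hs1 (by linarith)).symm
  have c3 : Close s 1 (n + 4) (γ.1 r).torus P' := (hcl r).mono hs0 hs1 (by linarith)
  have c4 := (c2.trans_one hs0 hs1 c1).mono hs0 hs1 (m' := n + 4) (by linarith)
  exact ((c4.trans_one hs0 hs1 c3).mono hs0 hs1 (m' := n) (by linarith)).dist_le hs0 hs1 hn0

/-- The ideal boundary is the disjoint union of a torus and a point. -/
def boundaryHomeomorph (hs0 : 0 ≤ s) (hs1 : s ≤ 1) :
    (UnitAddCircle × UnitAddCircle) ⊕ Unit ≃ₜ IdealBoundary (TwistedQuotient s) where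
  toEquiv := Equiv.ofBijective _ (boundaryPoint_bijective hs0 hs1)
  continuous_toFun := by
    refine Continuous.sumElim ?_ continuous_const
    exact continuous_quotient_mk'.comp (continuous_verticalRay hs0 hs1)
  continuous_invFun := by
    set e := Equiv.ofBijective _ (boundaryPoint_bijective hs0 hs1) with he
    have hinl {γ : GeodesicRay (TwistedQuotient s)} {P : UnitAddCircle × UnitAddCircle}
        (h : γ.endpoint = (verticalRay s P).endpoint) : e.symm γ.endpoint = .inl P :=
      e.symm_apply_eq.2 h
    have hinr {γ : GeodesicRay (TwistedQuotient s)} (h : IsDown γ) :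
        e.symm γ.endpoint = .inr () := e.symm_apply_eq.2 (h.endpoint_eq hs0 hs1)
    refine (isQuotientMap_quotient_mk' (s := asymptoticSetoid _)).continuous_iff.2
      (continuous_iff_continuousAt.2 fun γ ↦ ?_)
    change ContinuousAt (fun γ : GeodesicRay (TwistedQuotient s) ↦ e.symm γ.endpoint) γ
    rcases isUp_or_isDown hs0 hs1 γ with h | h
    · obtain ⟨P, hP, -⟩ := h.exists_endpoint_eq hs0 hs1
      rw [ContinuousAt, hinl hP]
      intro U hU
      obtain ⟨ε, hε, hball⟩ := Metric.mem_nhds_iff.1 (continuous_inl.continuousAt hU)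
      change ∀ᶠ γ' : GeodesicRay (TwistedQuotient s) in 𝓝 γ, e.symm γ'.endpoint ∈ U
      filter_upwards [eventually_isUp hs0 hs1 h hP hε] with γ' ⟨Q, hQ, hQP⟩
      rw [hinl hQ]
      exact hball hQP
    · rw [ContinuousAt, hinr h]
      refine tendsto_const_nhds.congr' ?_
      filter_upwards [eventually_isDown hs0 hs1 h] with γ' h'
      exact (hinr h').symm

end TwistedQuotient

/-! ### Gromov products and visual distances at infinity -/

theorem gromovProduct_nonneg {X : Type*} [PseudoMetricSpace X] (o x y : X) :
    0 ≤ gromovProduct o x y := by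
  have := dist_triangle_right x y o
  unfold gromovProduct
  linarith

theorem eventually_atTop_prod_le (a b : ℝ) :
    ∀ᶠ p : ℝ≥0 × ℝ≥0 in atTop, a ≤ p.1 ∧ b ≤ p.2 := by
  rw [← prod_atTop_atTop_eq]
  exact (NNReal.tendsto_coe_atTop.2 tendsto_id |>.eventually_ge_atTop a).prod_mk
    (NNReal.tendsto_coe_atTop.2 tendsto_id |>.eventually_ge_atTop b)

section BoundaryGromovProduct

variable {X : Type*} [PseudoMetricSpace X] {o : X} {ξ η : IdealBoundary X}

theorem le_boundaryGromovProduct {M : ℝ} (γ γ' : GeodesicRay X)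
    (h : ∀ᶠ p : ℝ≥0 × ℝ≥0 in atTop, M ≤ gromovProduct o (γ.1 p.1) (γ'.1 p.2)) :
    (M : EReal) ≤ boundaryGromovProduct o γ.endpoint γ'.endpoint := by
  refine le_iSup₂_of_le γ γ' (le_iSup₂_of_le rfl rfl ?_)
  refine le_liminf_of_le (by isBoundedDefault) ?_
  filter_upwards [h] with p hp using EReal.coe_le_coe_iff.2 hp

theorem exists_of_lt_boundaryGromovProduct {M : ℝ}
    (h : (M : EReal) < boundaryGromovProduct o ξ η) :
    ∃ γ γ' : GeodesicRay X, γ.endpoint = ξ ∧ γ'.endpoint = η ∧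
      ∀ᶠ p : ℝ≥0 × ℝ≥0 in atTop, M < gromovProduct o (γ.1 p.1) (γ'.1 p.2) := by
  simp only [boundaryGromovProduct, lt_iSup_iff] at h
  obtain ⟨γ, γ', h1, h2, h⟩ := h
  refine ⟨γ, γ', h1, h2, ?_⟩
  filter_upwards [eventually_lt_of_lt_liminf h] with p hp using EReal.coe_lt_coe_iff.1 hp

theorem boundaryGromovProduct_nonneg (o : X) (ξ η : IdealBoundary X) :
    0 ≤ boundaryGromovProduct o ξ η := by
  induction ξ using Quotient.ind with | _ γ
  induction η using Quotient.ind with | _ γ'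
  exact_mod_cast le_boundaryGromovProduct (M := 0) γ γ'
    (.of_forall fun p ↦ gromovProduct_nonneg _ _ _)

theorem boundaryGromovProduct_self (o : X) (ξ : IdealBoundary X) :
    boundaryGromovProduct o ξ ξ = ⊤ := by
  induction ξ using Quotient.ind with | _ γ
  refine EReal.eq_top_iff_forall_lt _ |>.2 fun M ↦ ?_
  refine lt_of_lt_of_le (EReal.coe_lt_coe_iff.2 (lt_add_one M))
    (le_boundaryGromovProduct γ γ ?_)
  set D := dist (γ.1 0) o
  filter_upwards [eventually_atTop_prod_le (M + 1 + D) (M + 1 + D)] with p hp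
  have h1 (r : ℝ≥0) : r - D ≤ dist (γ.1 r) o := by
    have := dist_triangle_right (γ.1 r) (γ.1 0) o
    rw [γ.2.dist_eq, NNReal.dist_eq, NNReal.coe_zero, sub_zero, NNReal.abs_eq] at this
    linarith
  have h2 : dist (γ.1 p.1) (γ.1 p.2) = |(p.1 : ℝ) - p.2| := by
    rw [γ.2.dist_eq, NNReal.dist_eq]
  have h3 := h1 p.1
  have h4 := h1 p.2
  unfold gromovProduct
  rw [h2]
  rcases abs_cases ((p.1 : ℝ) - p.2) with h5 | h5 <;> linarith

theorem visualDist_self (o : X) (ξ : IdealBoundary X) : visualDist o ξ ξ = 0 := by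
  simp [visualDist, boundaryGromovProduct_self]

theorem exists_boundaryGromovProduct_eq {M : ℝ} (h : boundaryGromovProduct o ξ η ≤ M) :
    ∃ b : ℝ, 0 ≤ b ∧ b ≤ M ∧ boundaryGromovProduct o ξ η = b := by
  have h0 := boundaryGromovProduct_nonneg o ξ η
  lift boundaryGromovProduct o ξ η to ℝ using
    ⟨(h.trans_lt (EReal.coe_lt_top M)).ne, ((EReal.bot_lt_zero).trans_le h0).ne'⟩ with b
  exact ⟨b, by exact_mod_cast h0, by exact_mod_cast h, rfl⟩

theorem visualDist_eq {b : ℝ} (h : boundaryGromovProduct o ξ η = b) :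
    visualDist o ξ η = ENNReal.ofReal (Real.exp (-b)) := by
  rw [visualDist, h, ← EReal.coe_neg, EReal.exp_coe]

end BoundaryGromovProduct

theorem abs_log_ofReal_exp_div (a b : ℝ) :
    (ENNReal.log (ENNReal.ofReal (Real.exp (-b)) / ENNReal.ofReal (Real.exp (-a)))).abs =
      ENNReal.ofReal |a - b| := by
  rw [← ENNReal.ofReal_div_of_pos (Real.exp_pos _), ← Real.exp_sub, ENNReal.log_ofReal,
    if_neg (Real.exp_pos _).not_ge, Real.log_exp, EReal.abs_def, sub_neg_eq_add, add_comm,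
    ← sub_eq_add_neg]

theorem abs_sub_le_mul_log_of_le {a b R : ℝ} (hR : 2 ≤ R) (ha : 0 ≤ a) (hb : 0 ≤ b) (haR : a ≤ R)
    (hab : a ≤ b + 19 + 2 * Real.log (2 + 2 * a)) (hba : b ≤ a + 19 + 2 * Real.log (2 + 2 * b)) :
    |a - b| ≤ 52 * Real.log R := by
  have hl := one_le_two_mul_log hR
  have h1 : Real.log (2 + 2 * a) ≤ Real.log (2 + 2 * R) :=
    Real.log_le_log (by linarith) (by linarith)
  have h2 := log_two_add_two_mul_le hR
  have l2 := Real.log_two_lt_d9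
  -- Only `a` is known to be at most `R`. A logarithm with small linear slope is absorbed into `b`
  -- in `hba`, giving a linear bound of `b` in `R`, after which its logarithm is `O(log R)`.
  have h3 : Real.log (2 + 2 * b) ≤ (2 + 2 * b) / 8 + 1.1 := by
    have k1 := Real.log_le_sub_one_of_pos (x := (2 + 2 * b) / 8) (by linarith)
    rw [Real.log_div (by linarith) (by norm_num)] at k1
    have k2 : Real.log 8 = 3 * Real.log 2 := by
      rw [show (8 : ℝ) = 2 ^ 3 by norm_num, Real.log_pow]; norm_num
    linarith
  have h4 : 2 + 2 * b ≤ 64 * R := by linarith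
  have h5 : Real.log (2 + 2 * b) ≤ 7 * Real.log R := by
    have k1 := Real.log_le_log (by linarith) h4
    rw [Real.log_mul (by norm_num) (by linarith)] at k1
    have k2 : Real.log 64 = 6 * Real.log 2 := by
      rw [show (64 : ℝ) = 2 ^ 6 by norm_num, Real.log_pow]; norm_num
    have k3 := Real.log_le_log two_pos hR
    linarith
  exact abs_sub_le_iff.2 ⟨by linarith, by linarith⟩

namespace TwistedQuotient

variable {s s' : ℝ} {P Q : UnitAddCircle × UnitAddCircle}

theorem le_boundaryGromovProduct_of_close {M : ℝ} (h : Close s 1 M P Q) :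
    ((M - 1 : ℝ) : EReal) ≤ boundaryGromovProduct (origin s) (verticalRay s P).endpoint
      (verticalRay s Q).endpoint := by
  refine le_boundaryGromovProduct _ _ ?_
  filter_upwards [eventually_atTop_prod_le M M] with p hp
  have h1 := abs_height_le_dist_origin ((verticalRay s P).1 p.1)
  have h2 := abs_height_le_dist_origin ((verticalRay s Q).1 p.2)
  have h3 := dist_le_of_close (p := (verticalRay s P).1 p.1) (q := (verticalRay s Q).1 p.2)
    h hp.1 hp.2
  change |(p.1 : ℝ)| ≤ _ at h1
  change |(p.2 : ℝ)| ≤ _ at h2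
  change _ ≤ (p.1 : ℝ) + (p.2 : ℝ) - 2 * M + 2 * 1 at h3
  rw [NNReal.abs_eq] at h1 h2
  unfold gromovProduct
  linarith

theorem isUp_of_endpoint_eq (hs0 : 0 ≤ s) (hs1 : s ≤ 1) {γ : GeodesicRay (TwistedQuotient s)}
    (h : γ.endpoint = (verticalRay s P).endpoint) : IsUp γ :=
  (isUp_or_isDown hs0 hs1 γ).resolve_right fun hd ↦
    verticalRay_endpoint_ne_downRay P (h.symm.trans (hd.endpoint_eq hs0 hs1))

theorem isDown_of_endpoint_eq (hs0 : 0 ≤ s) (hs1 : s ≤ 1) {γ : GeodesicRay (TwistedQuotient s)}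
    (h : γ.endpoint = (downRay s).endpoint) : IsDown γ :=
  (isUp_or_isDown hs0 hs1 γ).resolve_left fun hu ↦ by
    obtain ⟨P, hP, -⟩ := hu.exists_endpoint_eq hs0 hs1
    exact verticalRay_endpoint_ne_downRay P (hP.symm.trans h)

/-- Far out, arbitrary representing rays are already close to `P` and `Q` at height `M`; the
distance formula links the two rays at height `M - 9`, and two applications of `Close.trans_one`
cost 4 each. -/
theorem close_of_lt_boundaryGromovProduct (hs0 : 0 ≤ s) (hs1 : s ≤ 1) {M : ℝ}
    (h : (M : EReal) < boundaryGromovProduct (origin s) (verticalRay s P).endpoint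
      (verticalRay s Q).endpoint) : Close s 1 (M - 17) P Q := by
  obtain ⟨γ, γ', hP, hQ, h⟩ := exists_of_lt_boundaryGromovProduct h
  have key {γ : GeodesicRay (TwistedQuotient s)} {P : UnitAddCircle × UnitAddCircle}
      (hP : γ.endpoint = (verticalRay s P).endpoint) (r : ℝ≥0)
      (hr : |M| + 2 * |rayHeight γ 0| + 15 ≤ r) :
      0 ≤ (γ.1 r).height ∧ Close s 1 M (γ.1 r).torus P := by
    have hup := isUp_of_endpoint_eq hs0 hs1 hP
    obtain ⟨P', hP', hcl⟩ := hup.exists_endpoint_eq hs0 hs1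
    obtain rfl : P' = P := verticalRay_endpoint_injective hs0 hs1 (hP'.symm.trans hP)
    have h1 := hup r
    have h2 := abs_nonneg (rayHeight γ 0)
    have h3 := le_abs_self M
    have h4 := abs_nonneg M
    refine ⟨?_, (hcl r).mono hs0 hs1 (by linarith)⟩
    change 0 ≤ rayHeight γ r
    linarith
  obtain ⟨p, hp, hp1, hp2⟩ := (h.and (eventually_atTop_prod_le
    (|M| + 2 * |rayHeight γ 0| + 15) (|M| + 2 * |rayHeight γ' 0| + 15))).exists
  obtain ⟨h1, h1'⟩ := key hP p.1 hp1
  obtain ⟨h2, h2'⟩ := key hQ p.2 hp2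
  have h3 := dist_origin_le hs0 hs1 (γ.1 p.1)
  have h4 := dist_origin_le hs0 hs1 (γ'.1 p.2)
  rw [abs_of_nonneg h1] at h3
  rw [abs_of_nonneg h2] at h4
  have h5 : dist (γ.1 p.1) (γ'.1 p.2) <
      (γ.1 p.1).height + (γ'.1 p.2).height + 4 - 2 * M := by
    unfold gromovProduct at hp
    linarith
  have c1 := (close_of_dist_lt hs0 hs1 h5).mono hs0 hs1 (m' := M - 9) (by linarith)
  have c2 := (h1'.symm.mono hs0 hs1 (m' := M - 9) (by linarith)).trans_one hs0 hs1 c1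
  exact (c2.trans_one hs0 hs1 (h2'.mono hs0 hs1 (by linarith))).mono hs0 hs1 (by linarith)

theorem gromovProduct_le_two (hs0 : 0 ≤ s) (hs1 : s ≤ 1) {p q : TwistedQuotient s}
    (hp : 0 ≤ p.height) (hq : q.height ≤ 0) : gromovProduct (origin s) p q ≤ 2 := by
  have h1 := dist_origin_le hs0 hs1 p
  have h2 := dist_origin_le hs0 hs1 q
  have h3 := (abs_le.1 (abs_height_sub_le_dist p q)).1
  rw [abs_of_nonneg hp] at h1
  rw [abs_of_nonpos hq] at h2
  unfold gromovProduct
  linarith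

theorem IsUp.height_nonneg {γ : GeodesicRay (TwistedQuotient s)} (h : IsUp γ) {r : ℝ≥0}
    (hr : |rayHeight γ 0| + 2 ≤ r) : 0 ≤ (γ.1 r).height := by
  have := h r
  change 0 ≤ rayHeight γ r
  linarith

theorem IsDown.height_nonpos {γ : GeodesicRay (TwistedQuotient s)} (h : IsDown γ) {r : ℝ≥0}
    (hr : |rayHeight γ 0| + 2 ≤ r) : (γ.1 r).height ≤ 0 := by
  have := h r
  change rayHeight γ r ≤ 0
  linarith

theorem boundaryGromovProduct_vertical_down_le (hs0 : 0 ≤ s) (hs1 : s ≤ 1)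
    (P : UnitAddCircle × UnitAddCircle) :
    boundaryGromovProduct (origin s) (verticalRay s P).endpoint (downRay s).endpoint ≤
      (2 : ℝ) := by
  by_contra! h
  obtain ⟨γ, γ', h1, h2, h⟩ := exists_of_lt_boundaryGromovProduct h
  obtain ⟨p, hp, hp1, hp2⟩ := (h.and (eventually_atTop_prod_le
    (|rayHeight γ 0| + 2) (|rayHeight γ' 0| + 2))).exists
  exact hp.not_ge (gromovProduct_le_two hs0 hs1
    ((isUp_of_endpoint_eq hs0 hs1 h1).height_nonneg hp1)
    ((isDown_of_endpoint_eq hs0 hs1 h2).height_nonpos hp2))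

theorem boundaryGromovProduct_down_vertical_le (hs0 : 0 ≤ s) (hs1 : s ≤ 1)
    (P : UnitAddCircle × UnitAddCircle) :
    boundaryGromovProduct (origin s) (downRay s).endpoint (verticalRay s P).endpoint ≤
      (2 : ℝ) := by
  by_contra! h
  obtain ⟨γ, γ', h1, h2, h⟩ := exists_of_lt_boundaryGromovProduct h
  obtain ⟨p, hp, hp1, hp2⟩ := (h.and (eventually_atTop_prod_le
    (|rayHeight γ 0| + 2) (|rayHeight γ' 0| + 2))).exists
  refine hp.not_ge (le_of_eq_of_le ?_ (gromovProduct_le_two hs0 hs1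
    ((isUp_of_endpoint_eq hs0 hs1 h2).height_nonneg hp2)
    ((isDown_of_endpoint_eq hs0 hs1 h1).height_nonpos hp1)))
  unfold gromovProduct
  rw [dist_comm (γ.1 p.1) (γ'.1 p.2)]
  ring

/-- The Gromov product of the endpoints of two vertical rays. -/
theorem exists_boundaryGromovProduct_vertical (hs0 : 0 ≤ s) (hs1 : s ≤ 1) (hPQ : P ≠ Q) :
    ∃ b : ℝ, 0 ≤ b ∧ boundaryGromovProduct (origin s) (verticalRay s P).endpoint
      (verticalRay s Q).endpoint = b ∧ Close s 1 (b - 18) P Q ∧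
      ∀ M, Close s 1 M P Q → M - 1 ≤ b := by
  have h1 : ∃ m ≥ 0, ¬ Close s 1 m P Q := by
    by_contra! h
    exact hPQ (eq_of_forall_close hs0 hs1 h)
  obtain ⟨m, hm, hmPQ⟩ := h1
  obtain ⟨b, hb0, -, hb⟩ := exists_boundaryGromovProduct_eq (o := origin s)
    (ξ := (verticalRay s P).endpoint) (η := (verticalRay s Q).endpoint) (M := m + 17) (by
      by_contra! h
      have := close_of_lt_boundaryGromovProduct hs0 hs1 h
      rw [add_sub_cancel_right] at this
      exact hmPQ this)
  refine ⟨b, hb0, hb, ?_, fun M hM ↦ ?_⟩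
  · have := close_of_lt_boundaryGromovProduct (M := b - 1) (P := P) (Q := Q) hs0 hs1
      (by rw [hb]; exact EReal.coe_lt_coe_iff.2 (sub_one_lt b))
    exact this.mono hs0 hs1 (by linarith)
  · have := le_boundaryGromovProduct_of_close hM
    rw [hb] at this
    exact EReal.coe_le_coe_iff.1 this

/-- `Close.transfer` needs a nonnegative height, so `b < 18` is treated apart; there the additive
constant alone is enough. -/
theorem gromovProduct_comparison (hs0 : 0 ≤ s) (hs1 : s ≤ 1) (hs0' : 0 ≤ s') (hs1' : s' ≤ 1)
    {b b' : ℝ} (hb : 0 ≤ b) (hb' : 0 ≤ b') (h : Close s 1 (b - 18) P Q)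
    (h' : ∀ M, Close s' 1 M P Q → M - 1 ≤ b') : b ≤ b' + 19 + 2 * Real.log (2 + 2 * b) := by
  have hl : 0 ≤ Real.log (2 + 2 * b) := Real.log_nonneg (by linarith)
  rcases le_total 18 b with h0 | h0
  · have h1 := h' _ (h.transfer hs0 hs1 hs0' hs1' (by linarith))
    have h2 : Real.log (2 + 2 * (b - 18)) ≤ Real.log (2 + 2 * b) :=
      Real.log_le_log (by linarith) (by linarith)
    linarith
  · linarith

/-- The identity of `𝕋²`, extended to the ideal boundaries. -/
def boundaryChange (hs0 : 0 ≤ s) (hs1 : s ≤ 1) (hs0' : 0 ≤ s') (hs1' : s' ≤ 1) :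
    IdealBoundary (TwistedQuotient s) ≃ₜ IdealBoundary (TwistedQuotient s') :=
  (boundaryHomeomorph hs0 hs1).symm.trans (boundaryHomeomorph hs0' hs1')

theorem boundaryChange_boundaryPoint (hs0 : 0 ≤ s) (hs1 : s ≤ 1) (hs0' : 0 ≤ s') (hs1' : s' ≤ 1)
    (x : (UnitAddCircle × UnitAddCircle) ⊕ Unit) :
    boundaryChange hs0 hs1 hs0' hs1' (boundaryPoint s x) = boundaryPoint s' x :=
  congrArg (boundaryPoint s') ((boundaryHomeomorph hs0 hs1).symm_apply_apply x)

theorem exists_boundaryGromovProduct_eq_of_ne (hs0 : 0 ≤ s) (hs1 : s ≤ 1) (hs0' : 0 ≤ s')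
    (hs1' : s' ≤ 1) {x y : (UnitAddCircle × UnitAddCircle) ⊕ Unit} (hxy : x ≠ y) :
    ∃ a b : ℝ, 0 ≤ a ∧ 0 ≤ b ∧
      boundaryGromovProduct (origin s) (boundaryPoint s x) (boundaryPoint s y) = a ∧
      boundaryGromovProduct (origin s') (boundaryPoint s' x) (boundaryPoint s' y) = b ∧
      a ≤ b + 19 + 2 * Real.log (2 + 2 * a) ∧ b ≤ a + 19 + 2 * Real.log (2 + 2 * b) := by
  have mixed {a b : ℝ} (ha : 0 ≤ a) (ha' : a ≤ 2) (hb : 0 ≤ b) :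
      a ≤ b + 19 + 2 * Real.log (2 + 2 * a) := by
    have : 0 ≤ Real.log (2 + 2 * a) := Real.log_nonneg (by linarith)
    linarith
  rcases x with P | _ <;> rcases y with Q | _
  · have hPQ : P ≠ Q := fun h ↦ hxy (congrArg _ h)
    obtain ⟨a, ha0, ha, ha1, ha2⟩ := exists_boundaryGromovProduct_vertical hs0 hs1 hPQ
    obtain ⟨b, hb0, hb, hb1, hb2⟩ := exists_boundaryGromovProduct_vertical hs0' hs1' hPQ
    exact ⟨a, b, ha0, hb0, ha, hb, gromovProduct_comparison hs0 hs1 hs0' hs1' ha0 hb0 ha1 hb2,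
      gromovProduct_comparison hs0' hs1' hs0 hs1 hb0 ha0 hb1 ha2⟩
  · obtain ⟨a, ha0, ha1, ha⟩ := exists_boundaryGromovProduct_eq
      (boundaryGromovProduct_vertical_down_le hs0 hs1 P)
    obtain ⟨b, hb0, hb1, hb⟩ := exists_boundaryGromovProduct_eq
      (boundaryGromovProduct_vertical_down_le hs0' hs1' P)
    exact ⟨a, b, ha0, hb0, ha, hb, mixed ha0 ha1 hb0, mixed hb0 hb1 ha0⟩
  · obtain ⟨a, ha0, ha1, ha⟩ := exists_boundaryGromovProduct_eq
      (boundaryGromovProduct_down_vertical_le hs0 hs1 Q)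
    obtain ⟨b, hb0, hb1, hb⟩ := exists_boundaryGromovProduct_eq
      (boundaryGromovProduct_down_vertical_le hs0' hs1' Q)
    exact ⟨a, b, ha0, hb0, ha, hb, mixed ha0 ha1 hb0, mixed hb0 hb1 ha0⟩
  · exact absurd rfl hxy

theorem boundaryDistortion_boundaryChange_le (hs0 : 0 ≤ s) (hs1 : s ≤ 1) (hs0' : 0 ≤ s')
    (hs1' : s' ≤ 1) {R : ℝ} (hR : 2 ≤ R) :
    boundaryDistortion (origin s) (origin s') (boundaryChange hs0 hs1 hs0' hs1') R ≤
      ENNReal.ofReal (52 * Real.log R) := by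
  refine iSup₂_le fun ξ η ↦ iSup_le fun h ↦ ?_
  obtain ⟨x, rfl⟩ := (boundaryPoint_bijective hs0 hs1).2 ξ
  obtain ⟨y, rfl⟩ := (boundaryPoint_bijective hs0 hs1).2 η
  simp only [boundaryChange_boundaryPoint] at h ⊢
  -- On the diagonal both visual distances are 0, which the threshold `exp (-R)` excludes.
  have hxy : x ≠ y := by
    rintro rfl
    simp only [visualDist_self, or_self, nonpos_iff_eq_zero, ENNReal.ofReal_eq_zero] at h
    exact h.not_gt (Real.exp_pos _)
  obtain ⟨a, b, ha0, hb0, ha, hb, hab, hba⟩ :=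
    exists_boundaryGromovProduct_eq_of_ne hs0 hs1 hs0' hs1' hxy
  rw [visualDist_eq ha, visualDist_eq hb, ENNReal.ofReal_le_ofReal_iff (Real.exp_pos _).le,
    ENNReal.ofReal_le_ofReal_iff (Real.exp_pos _).le, Real.exp_le_exp, Real.exp_le_exp,
    neg_le_neg_iff, neg_le_neg_iff] at h
  rw [visualDist_eq ha, visualDist_eq hb, abs_log_ofReal_exp_div]
  refine ENNReal.ofReal_le_ofReal ?_
  rcases h with h | h
  · exact abs_sub_le_mul_log_of_le hR ha0 hb0 h hab hba
  · rw [abs_sub_comm]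
    exact abs_sub_le_mul_log_of_le hR hb0 ha0 h hba hab

end TwistedQuotient

theorem mainTheorem11 :
    ¬ QuasiIsometric (TwistedQuotient 0) (TwistedQuotient 1) ∧
    (∃ θ : IdealBoundary (TwistedQuotient 0) ≃ₜ IdealBoundary (TwistedQuotient 1),
      (∀ P : UnitAddCircle × UnitAddCircle,
        θ (TwistedQuotient.verticalRay 0 P).endpoint = (TwistedQuotient.verticalRay 1 P).endpoint) ∧
      ∃ C : ℝ, ∀ R : ℝ, 2 ≤ R →
        boundaryDistortion (TwistedQuotient.origin 0) (TwistedQuotient.origin 1) θ R ≤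
          ENNReal.ofReal (C * Real.log R)) ∧
    (∃ C : ℝ, ∀ R : ℝ, 2 ≤ R →
      distortionGrowth (TwistedQuotient.origin 0) (TwistedQuotient.origin 1) R ≤
        ENNReal.ofReal (C * Real.log R) ∧
      distortionGrowth (TwistedQuotient.origin 1) (TwistedQuotient.origin 0) R ≤
        ENNReal.ofReal (C * Real.log R)) ∧
    (∃ C : ℝ, ∀ R : ℝ, 2 ≤ R →
      ∃ (lam c : ℝ) (f : Metric.closedBall (TwistedQuotient.origin 0) R →
          Metric.closedBall (TwistedQuotient.origin 1) R)
        (g : Metric.closedBall (TwistedQuotient.origin 1) R →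
          Metric.closedBall (TwistedQuotient.origin 0) R),
        IsQuasiIsometryPair lam c f g ∧ lam + c ≤ C * Real.log R) := by
  refine ⟨TwistedQuotient.not_quasiIsometric, ?_, ⟨56, fun R hR ↦
    ⟨TwistedQuotient.distortionGrowth_le le_rfl zero_le_one zero_le_one le_rfl hR,
      TwistedQuotient.distortionGrowth_le zero_le_one le_rfl le_rfl zero_le_one hR⟩⟩,
    ⟨64, fun R hR ↦ TwistedQuotient.exists_isQuasiIsometryPair_closedBall
      le_rfl zero_le_one zero_le_one le_rfl hR⟩⟩
  exact ⟨TwistedQuotient.boundaryChange le_rfl zero_le_one zero_le_one le_rfl,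
    fun P ↦ TwistedQuotient.boundaryChange_boundaryPoint le_rfl zero_le_one zero_le_one le_rfl
      (.inl P),
    52, fun R hR ↦ TwistedQuotient.boundaryDistortion_boundaryChange_le le_rfl zero_le_one
      zero_le_one le_rfl hR⟩

end
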